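/- Let $\mathbb{K}\in\{\mathbb{R},\mathbb{C}\}$, let $M$ be a smooth finite-dimensional manifold whose topology is Hausdorff and second countable, and let $E$ and $F$ be smooth $\mathbb{K}$-vector bundles over $M$ of finite rank. Let $C^\infty(M)$ be the $\mathbb{K}$-algebra of smooth $\mathbb{K}$-valued functions on $M$. *Section spaces.* The space $\Gamma(F)$ of smooth sections of $F$ carries the locally convex topology given by the seminorms $s\mapsto \sup_{x\in K}\|D^k s_{\mathrm{loc}}(x)\|$, where $k\ge 0$, $s_{\mathrm{loc}}$ is the local representation of $s$ in a chart of $M$ and a vector bundle trivialization of $F$, and $K$ is a compact subset of their common domain. For compact $L\subseteq M$ let $\Gamma_{c,L}(E)\subseteq\Gamma(E)$ be the subspace of sections with support in $L$, with the subspace topology. The space $\Gamma_c(E)$ of compactly supported smooth sections carries the strict inductive limit (LF) topology of the spaces $\Gamma_{c,L}(E)$, i.e. the finest locally convex topology for which all inclusions $\Gamma_{c,L}(E)\to\Gamma_c(E)$ are continuous. The same applies to $\Gamma_c(E\otimes F)$. *Bornological tensor product.* A map between locally convex spaces is called bounded if it maps bounded sets to bounded sets. Let $P,Q$ be locally convex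 spaces that are also $C^\infty(M)$-modules (with compatible scalar multiplication) on which multiplication by each fixed $f\in C^\infty(M)$ is bounded. Let $P\otimes_\beta Q$ be the algebraic tensor product over $\mathbb{K}$ with the finest locally convex topology for which $(p,q)\mapsto p\otimes q$ is bounded. Let $J$ be the closure in $P\otimes_\beta Q$ of the additive subgroup generated by all $fp\otimes q-p\otimes fq$ with $f\in C^\infty(M)$, $p\in P$, $q\in Q$. Set $P\otimes^\beta_{C^\infty(M)}Q := (P\otimes_\beta Q)/J$ with the quotient topology and the $C^\infty(M)$-module structure $f\cdot[p\otimes q]=[fp\otimes q]$. **Theorem.** There is an isomorphism of $C^\infty(M)$-modules $$\Phi:\ \Gamma_c(E)\otimes^\beta_{C^\infty(M)}\Gamma(F)\ \longrightarrow\ \Gamma_c(E\otimes F),\qquad \Phi([s\otimes t])(x)=s(x)\otimes t(x)\quad (s\in\Gamma_c(E),\ t\in\Gamma(F),\ x\in M),$$ such that both $\Phi$ and $\Phi^{-1}$ are bounded. -/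

import Mathlib

open Bundle Set Topology
open scoped Manifold ContDiff TensorProduct

noncomputable section

set_option linter.unusedSectionVars false

/-! ### Bounded maps and finest locally convex topologies -/

/-- A map between topological vector spaces is bounded if it maps von Neumann bounded sets to
von Neumann bounded sets. -/
def IsBoundedMap (𝕜 : Type*) [NormedField 𝕜] {X Y : Type*} [AddCommGroup X] [Module 𝕜 X]
    [TopologicalSpace X] [AddCommGroup Y] [Module 𝕜 Y] [TopologicalSpace Y] (f : X → Y) : Prop :=
  ∀ B : Set X, Bornology.IsVonNBounded 𝕜 B → Bornology.IsVonNBounded 𝕜 (f '' B)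

/-- The finest locally convex topology (i.e. topology defined by a family of seminorms, not
necessarily Hausdorff) on the `𝕜`-vector space `V` having the property `P`: the projective
topology with respect to the identity maps into all locally convex topologies with `P`. -/
@[reducible]
def finestLocallyConvex (𝕜 V : Type*) [NormedField 𝕜] [AddCommGroup V] [Module 𝕜 V]
    (P : TopologicalSpace V → Prop) : TopologicalSpace V :=
  sInf {t | PolynormableSpace 𝕜 V (topology := t) ∧ P t}

theorem polynormable_finestLocallyConvex (𝕜 V : Type*) [NormedField 𝕜] [AddCommGroup V]
    [Module 𝕜 V] (P : TopologicalSpace V → Prop) :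
    PolynormableSpace 𝕜 V (topology := finestLocallyConvex 𝕜 V P) :=
  PolynormableSpace.sInf fun _ h => h.1

/-! ### The bornological tensor product over an algebra -/

section BornologicalTensor

variable (𝕜 A M N : Type*) [RCLike 𝕜] [CommRing A] [Algebra 𝕜 A]
  [AddCommGroup M] [Module 𝕜 M] [Module A M] [IsScalarTower 𝕜 A M] [TopologicalSpace M]
  [AddCommGroup N] [Module 𝕜 N] [Module A N] [IsScalarTower 𝕜 A N] [TopologicalSpace N]

/-- Multiplication by every fixed element of `A` is a bounded map `M → M`. Every bounded
`A`-module has this property. -/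
class BoundedConstSMul : Prop where
  isBoundedMap_smul : ∀ a : A, IsBoundedMap 𝕜 (fun m : M => a • m)

/-- The topology of `M ⊗_β N`: the finest locally convex topology on the algebraic tensor product
over `𝕜` for which `(m, n) ↦ m ⊗ n` is bounded. -/
@[reducible]
def bornologicalTensorTopology : TopologicalSpace (M ⊗[𝕜] N) :=
  finestLocallyConvex 𝕜 (M ⊗[𝕜] N) fun t =>
    letI := t
    IsBoundedMap 𝕜 (fun p : M × N => p.1 ⊗ₜ[𝕜] p.2)

theorem isBoundedMap_tmul :
    letI := bornologicalTensorTopology 𝕜 M N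
    IsBoundedMap 𝕜 (fun p : M × N => p.1 ⊗ₜ[𝕜] p.2) := by
  intro B hB V hV
  rw [bornologicalTensorTopology, finestLocallyConvex, nhds_sInf] at hV
  have key : Filter.absorbing 𝕜 ((fun p : M × N => p.1 ⊗ₜ[𝕜] p.2) '' B) ≤
      ⨅ t ∈ {t | PolynormableSpace 𝕜 (M ⊗[𝕜] N) (topology := t) ∧
        (letI := t; IsBoundedMap 𝕜 (fun p : M × N => p.1 ⊗ₜ[𝕜] p.2))},
        @nhds (M ⊗[𝕜] N) t 0 :=
    le_iInf₂ fun t ht W hW => ht.2 B hB hW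
  exact key hV

/-- The additive subgroup `J₀` generated by all `m a ⊗ n - m ⊗ a n`. -/
def balancedRelations : AddSubgroup (M ⊗[𝕜] N) :=
  AddSubgroup.closure
    {z | ∃ (a : A) (m : M) (n : N), z = (a • m) ⊗ₜ[𝕜] n - m ⊗ₜ[𝕜] (a • n)}

variable {𝕜 A M N} in
theorem lsmul_mem_balancedRelations (a : A) {z : M ⊗[𝕜] N}
    (hz : z ∈ balancedRelations 𝕜 A M N) : a • z ∈ balancedRelations 𝕜 A M N := by
  induction hz using AddSubgroup.closure_induction with
  | mem x hx =>
    obtain ⟨b, m, n, rfl⟩ := hx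
    refine AddSubgroup.subset_closure ⟨b, a • m, n, ?_⟩
    rw [smul_sub, TensorProduct.smul_tmul', TensorProduct.smul_tmul', smul_comm a b m]
  | zero => rw [smul_zero]; exact zero_mem _
  | add x y _ _ hx hy => rw [smul_add]; exact add_mem hx hy
  | neg x _ hx => rw [smul_neg]; exact neg_mem hx

variable {𝕜 A M N} in
theorem continuous_lsmul_bornologicalTensor [BoundedConstSMul 𝕜 A M] (a : A) :
    letI := bornologicalTensorTopology 𝕜 M N
    Continuous (fun z : M ⊗[𝕜] N => a • z) := by
  let τ : TopologicalSpace (M ⊗[𝕜] N) := bornologicalTensorTopology 𝕜 M N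
  have : PolynormableSpace 𝕜 (M ⊗[𝕜] N) := polynormable_finestLocallyConvex _ _ _
  let L : (M ⊗[𝕜] N) →ₗ[𝕜] (M ⊗[𝕜] N) := Algebra.lsmul 𝕜 𝕜 (M ⊗[𝕜] N) a
  change Continuous L
  rw [continuous_iff_le_induced]
  refine sInf_le ⟨PolynormableSpace.induced L, ?_⟩
  intro B hB V hV
  rw [nhds_induced, map_zero] at hV
  obtain ⟨W, hW, hWV⟩ := hV
  have h1 : Bornology.IsVonNBounded 𝕜 (Prod.map (fun m : M => a • m) id '' B) := by
    have hS := BoundedConstSMul.isBoundedMap_smul (𝕜 := 𝕜) (M := M) a _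
      (hB.image (ContinuousLinearMap.fst 𝕜 M N))
    have hT := hB.image (ContinuousLinearMap.snd 𝕜 M N)
    intro U hU
    rw [Prod.zero_eq_mk, nhds_prod_eq, Filter.mem_prod_iff] at hU
    obtain ⟨U₁, hU₁, U₂, hU₂, hU⟩ := hU
    have h1 := hS hU₁
    have h2 := hT hU₂
    rw [absorbs_iff_eventually_cobounded_mapsTo] at h1 h2 ⊢
    filter_upwards [h1, h2] with c hc₁ hc₂
    rintro _ ⟨p, hp, rfl⟩
    exact hU ⟨hc₁ ⟨_, ⟨p, hp, rfl⟩, rfl⟩, hc₂ ⟨p, hp, rfl⟩⟩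
  have h2 := isBoundedMap_tmul 𝕜 M N _ h1 hW
  rw [absorbs_iff_eventually_cobounded_mapsTo] at h2 ⊢
  filter_upwards [h2] with c hc
  rintro _ ⟨p, hp, rfl⟩
  refine hWV ?_
  have := hc ⟨_, ⟨p, hp, rfl⟩, rfl⟩
  simp only [Set.mem_preimage, map_smul]
  exact this

/-- The closure `J` of `J₀` in `M ⊗_β N`. It is a sub-`A`-module for the action of `A` on the
left factor. -/
def closedBalancedRelations [BoundedConstSMul 𝕜 A M] : Submodule A (M ⊗[𝕜] N) :=
  letI := bornologicalTensorTopology 𝕜 M N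
  haveI : PolynormableSpace 𝕜 (M ⊗[𝕜] N) := polynormable_finestLocallyConvex _ _ _
  haveI : IsTopologicalAddGroup (M ⊗[𝕜] N) :=
    (PolynormableSpace.withSeminorms 𝕜 (M ⊗[𝕜] N)).topologicalAddGroup
  { (balancedRelations 𝕜 A M N).topologicalClosure with
    smul_mem' := by
      intro a z hz
      refine map_mem_closure (continuous_lsmul_bornologicalTensor a) hz fun w hw => ?_
      exact lsmul_mem_balancedRelations a hw }

/-- The bornological tensor product `M ⊗_A^β N := (M ⊗_β N) / J`. -/
def BornologicalTensor [BoundedConstSMul 𝕜 A M] : Type _ :=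
  (M ⊗[𝕜] N) ⧸ closedBalancedRelations 𝕜 A M N

namespace BornologicalTensor

variable [BoundedConstSMul 𝕜 A M]

instance : AddCommGroup (BornologicalTensor 𝕜 A M N) :=
  inferInstanceAs (AddCommGroup ((M ⊗[𝕜] N) ⧸ closedBalancedRelations 𝕜 A M N))

instance : Module A (BornologicalTensor 𝕜 A M N) :=
  inferInstanceAs (Module A ((M ⊗[𝕜] N) ⧸ closedBalancedRelations 𝕜 A M N))

instance : Module 𝕜 (BornologicalTensor 𝕜 A M N) :=
  inferInstanceAs (Module 𝕜 ((M ⊗[𝕜] N) ⧸ closedBalancedRelations 𝕜 A M N))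

instance : IsScalarTower 𝕜 A (BornologicalTensor 𝕜 A M N) :=
  inferInstanceAs (IsScalarTower 𝕜 A ((M ⊗[𝕜] N) ⧸ closedBalancedRelations 𝕜 A M N))

/-- The quotient topology. -/
instance : TopologicalSpace (BornologicalTensor 𝕜 A M N) :=
  (bornologicalTensorTopology 𝕜 M N).coinduced
    (Submodule.Quotient.mk : M ⊗[𝕜] N → (M ⊗[𝕜] N) ⧸ closedBalancedRelations 𝕜 A M N)

variable {M N} in
/-- The canonical map `⊗_A^β : M × N → M ⊗_A^β N`. -/
def tmul (m : M) (n : N) : BornologicalTensor 𝕜 A M N :=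
  (Submodule.Quotient.mk (m ⊗ₜ[𝕜] n) : (M ⊗[𝕜] N) ⧸ closedBalancedRelations 𝕜 A M N)

end BornologicalTensor

end BornologicalTensor

/-! ### Smooth vector bundles and their sections -/

section Sections

/-- The smooth `𝕜`-valued functions on `M`, as a subalgebra of all functions. -/
def smoothFunctionSubalgebra (𝕜 H M : Type*) [RCLike 𝕜] [NormedAddCommGroup H] [NormedSpace ℝ H]
    [TopologicalSpace M] [ChartedSpace H M] : Subalgebra 𝕜 (M → 𝕜) where
  carrier := {f | ContMDiff 𝓘(ℝ, H) 𝓘(ℝ, 𝕜) ∞ f}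
  mul_mem' hf hg :=
    (isBoundedBilinearMap_mul (𝕜 := ℝ) (A := 𝕜)).contDiff.contMDiff.comp (hf.prodMk_space hg)
  add_mem' hf hg := ContMDiff.add hf hg
  algebraMap_mem' _ := contMDiff_const

/-- The algebra `C^∞(M)` of smooth `𝕜`-valued functions on `M`. -/
def SmoothFunction (𝕜 H M : Type*) [RCLike 𝕜] [NormedAddCommGroup H] [NormedSpace ℝ H]
    [TopologicalSpace M] [ChartedSpace H M] : Type _ := smoothFunctionSubalgebra 𝕜 H M

section

variable (𝕜 H M : Type*) [RCLike 𝕜] [NormedAddCommGroup H] [NormedSpace ℝ H]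
  [TopologicalSpace M] [ChartedSpace H M]

instance : CommRing (SmoothFunction 𝕜 H M) :=
  inferInstanceAs (CommRing (smoothFunctionSubalgebra 𝕜 H M))

instance : Algebra 𝕜 (SmoothFunction 𝕜 H M) :=
  inferInstanceAs (Algebra 𝕜 (smoothFunctionSubalgebra 𝕜 H M))

end

variable (𝕜 H : Type*) {M : Type*} [RCLike 𝕜] [NormedAddCommGroup H] [NormedSpace ℝ H]
  [TopologicalSpace M] [ChartedSpace H M]
  (F : Type*) [NormedAddCommGroup F] [NormedSpace 𝕜 F] [NormedSpace ℝ F] [IsScalarTower ℝ 𝕜 F]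
  (E : M → Type*) [TopologicalSpace (TotalSpace F E)]
  [∀ x, AddCommGroup (E x)] [∀ x, Module 𝕜 (E x)] [∀ x, TopologicalSpace (E x)]
  [FiberBundle F E] [VectorBundle 𝕜 F E]

/-- A real or complex vector bundle with typical fibre `F` over the real manifold `M` is smooth if
its transition functions `x ↦ (e' ∘ e⁻¹)_x ∈ L(F, F)` are smooth. For `𝕜 = ℝ` this is
`ContMDiffVectorBundle ∞ F E 𝓘(ℝ, H)`; Mathlib's class does not allow complex bundles over real
manifolds. -/
class SmoothVectorBundle : Prop where
  contMDiffOn_coordChangeL :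
    ∀ (e e' : Trivialization F (π F E)) [MemTrivializationAtlas e] [MemTrivializationAtlas e'],
      ContMDiffOn 𝓘(ℝ, H) 𝓘(ℝ, F →L[𝕜] F) ∞ (fun b : M => (e.coordChangeL 𝕜 e' b : F →L[𝕜] F))
        (e.baseSet ∩ e'.baseSet)

/-- The pointwise action `(f • s)(x) = f(x) • s(x)` of `C^∞(M)` on set-theoretic sections. -/
instance : Module (SmoothFunction 𝕜 H M) (∀ x, E x) where
  smul f s x := f.1 x • s x
  one_smul s := funext fun x => one_smul 𝕜 (s x)
  mul_smul f g s := funext fun x => mul_smul (f.1 x) (g.1 x) (s x)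
  smul_zero f := funext fun x => smul_zero (f.1 x)
  smul_add f s t := funext fun x => smul_add (f.1 x) (s x) (t x)
  add_smul f g s := funext fun x => add_smul (f.1 x) (g.1 x) (s x)
  zero_smul s := funext fun x => zero_smul 𝕜 (s x)

/-- The `C^∞(M)`-module of smooth sections, as a submodule of all (set-theoretic) sections with the
pointwise operations. -/
def smoothSectionSubmodule : Submodule (SmoothFunction 𝕜 H M) (∀ x, E x) where
  carrier := {s | ContMDiff 𝓘(ℝ, H) (𝓘(ℝ, H).prod 𝓘(ℝ, F)) ∞ (fun x => TotalSpace.mk' F x (s x))}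
  add_mem' := by
    intro s t hs ht x
    have h1 := (contMDiffAt_section x).1 (hs x)
    have h2 := (contMDiffAt_section x).1 (ht x)
    refine (contMDiffAt_section x).2 ((h1.add h2).congr_of_eventuallyEq ?_)
    filter_upwards [(trivializationAt F E x).open_baseSet.mem_nhds
      (mem_baseSet_trivializationAt F E x)] with y hy
    exact ((trivializationAt F E x).linear 𝕜 hy).1 _ _
  zero_mem' := by
    intro x
    refine (contMDiffAt_section x).2 ((contMDiffAt_const (c := (0 : F))).congr_of_eventuallyEq ?_)
    filter_upwards [(trivializationAt F E x).open_baseSet.mem_nhds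
      (mem_baseSet_trivializationAt F E x)] with y hy
    exact ((trivializationAt F E x).linear 𝕜 hy).mk'.map_zero
  smul_mem' := by
    intro f s hs x
    have h1 := (contMDiffAt_section x).1 (hs x)
    refine (contMDiffAt_section x).2
      (((isBoundedBilinearMap_smul (𝕜 := ℝ) (A := 𝕜) (E := F)).contDiff.contMDiff.contMDiffAt.comp x
        (ContMDiffAt.prodMk_space (f.2 x) h1)).congr_of_eventuallyEq ?_)
    filter_upwards [(trivializationAt F E x).open_baseSet.mem_nhds
      (mem_baseSet_trivializationAt F E x)] with y hy
    exact ((trivializationAt F E x).linear 𝕜 hy).2 _ _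

instance : IsScalarTower 𝕜 (SmoothFunction 𝕜 H M) (∀ x, E x) :=
  ⟨fun c f s => funext fun x => smul_assoc c (f.1 x) (s x)⟩

/-- The space `Γ(E)` of smooth sections of the vector bundle `E`. -/
def SmoothSection : Type _ := smoothSectionSubmodule 𝕜 H F E

namespace SmoothSection

instance : AddCommGroup (SmoothSection 𝕜 H F E) :=
  inferInstanceAs (AddCommGroup (smoothSectionSubmodule 𝕜 H F E))

instance : Module (SmoothFunction 𝕜 H M) (SmoothSection 𝕜 H F E) :=
  inferInstanceAs (Module (SmoothFunction 𝕜 H M) (smoothSectionSubmodule 𝕜 H F E))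

instance : Module 𝕜 (SmoothSection 𝕜 H F E) :=
  inferInstanceAs (Module 𝕜 (smoothSectionSubmodule 𝕜 H F E))

instance : IsScalarTower 𝕜 (SmoothFunction 𝕜 H M) (SmoothSection 𝕜 H F E) :=
  inferInstanceAs (IsScalarTower 𝕜 (SmoothFunction 𝕜 H M) (smoothSectionSubmodule 𝕜 H F E))

instance : CoeFun (SmoothSection 𝕜 H F E) (fun _ => ∀ x, E x) := ⟨fun s => s.1⟩

variable {𝕜 H F E}

/-- The domain `φ(U ∩ V)` of the local representation in a chart `(U, φ)` and a local
trivialization over `V`. -/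
def localDomain (φ : OpenPartialHomeomorph M H) (e : Trivialization F (π F E)) : Set H :=
  φ.target ∩ φ.symm ⁻¹' e.baseSet

/-- The local representation `pr₂ ∘ e ∘ s ∘ φ⁻¹` of a section, considered on
`localDomain φ e`. -/
def localRep (φ : OpenPartialHomeomorph M H) (e : Trivialization F (π F E)) (s : ∀ x, E x) :
    H → F :=
  fun y => (e ⟨φ.symm y, s (φ.symm y)⟩).2

theorem isOpen_localDomain (φ : OpenPartialHomeomorph M H) (e : Trivialization F (π F E)) :
    IsOpen (localDomain φ e) :=
  φ.isOpen_inter_preimage_symm e.open_baseSet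

theorem contDiffOn_localRep [IsManifold 𝓘(ℝ, H) ∞ M] [SmoothVectorBundle 𝕜 H F E]
    {φ : OpenPartialHomeomorph M H} (hφ : φ ∈ atlas H M) (e : Trivialization F (π F E))
    [MemTrivializationAtlas e] (s : SmoothSection 𝕜 H F E) :
    ContDiffOn ℝ ∞ (localRep φ e s) (localDomain φ e) := by
  have h1 : ContMDiffOn 𝓘(ℝ, H) 𝓘(ℝ, F) ∞ (fun x => (e ⟨x, s x⟩).2) e.baseSet := by
    intro x hx
    refine ContMDiffAt.contMDiffWithinAt ?_
    have h0 := (contMDiffAt_section x).1 (s.2 x)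
    have hx0 := mem_baseSet_trivializationAt F E x
    have hc := (SmoothVectorBundle.contMDiffOn_coordChangeL (𝕜 := 𝕜) (H := H)
      (trivializationAt F E x) e).contMDiffAt
        (((trivializationAt F E x).open_baseSet.inter e.open_baseSet).mem_nhds ⟨hx0, hx⟩)
    have hR : ContMDiffAt 𝓘(ℝ, H) 𝓘(ℝ, F →L[ℝ] F) ∞ (fun b : M =>
        ((trivializationAt F E x).coordChangeL 𝕜 e b : F →L[𝕜] F).restrictScalars ℝ) x :=
      ((ContinuousLinearMap.restrictScalarsL 𝕜 F F ℝ ℝ).contDiff.contMDiff.contMDiffAt).comp x hc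
    refine (hR.clm_apply h0).congr_of_eventuallyEq ?_
    filter_upwards [((trivializationAt F E x).open_baseSet.inter e.open_baseSet).mem_nhds
      ⟨hx0, hx⟩] with y hy
    rw [ContinuousLinearMap.coe_restrictScalars', ContinuousLinearEquiv.coe_coe,
      Trivialization.coordChangeL_apply _ _ hy]
    rw [(trivializationAt F E x).symm_proj_apply ⟨y, s y⟩ hy.1]
  have h2 : ContMDiffOn 𝓘(ℝ, H) 𝓘(ℝ, H) ∞ φ.symm φ.target :=
    contMDiffOn_symm_of_mem_maximalAtlas (IsManifold.subset_maximalAtlas hφ)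
  rw [← contMDiffOn_iff_contDiffOn]
  exact h1.comp (h2.mono inter_subset_left) fun y hy => hy.2

theorem localRep_add (φ : OpenPartialHomeomorph M H) (e : Trivialization F (π F E))
    [MemTrivializationAtlas e] (s t : SmoothSection 𝕜 H F E) :
    EqOn (localRep φ e (s + t : SmoothSection 𝕜 H F E)) (localRep φ e s + localRep φ e t)
      (localDomain φ e) :=
  fun _ hy => (e.linear 𝕜 hy.2).1 _ _

theorem localRep_const_smul (φ : OpenPartialHomeomorph M H) (e : Trivialization F (π F E))
    [MemTrivializationAtlas e] (c : 𝕜) (s : SmoothSection 𝕜 H F E) :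
    EqOn (localRep φ e (c • s : SmoothSection 𝕜 H F E)) (c • localRep φ e s)
      (localDomain φ e) :=
  fun _ hy => (e.linear 𝕜 hy.2).2 _ _

theorem localRep_smul (φ : OpenPartialHomeomorph M H) (e : Trivialization F (π F E))
    [MemTrivializationAtlas e] (f : SmoothFunction 𝕜 H M) (s : SmoothSection 𝕜 H F E) :
    EqOn (localRep φ e (f • s : SmoothSection 𝕜 H F E))
      (fun y => f.1 (φ.symm y) • localRep φ e s y) (localDomain φ e) :=
  fun _ hy => (e.linear 𝕜 hy.2).2 _ _

/-- A chart of `M`, a local trivialization of `E`, a compact subset `K` of `U ∩ V` and an order of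
differentiation. -/
structure SeminormIndex (H : Type*) {M : Type*} [NormedAddCommGroup H] [NormedSpace ℝ H]
    [TopologicalSpace M] [ChartedSpace H M] (F : Type*) [NormedAddCommGroup F]
    (E : M → Type*) [TopologicalSpace (TotalSpace F E)] [∀ x, TopologicalSpace (E x)]
    [FiberBundle F E] where
  chart : OpenPartialHomeomorph M H
  chart_mem : chart ∈ atlas H M
  triv : Trivialization F (π F E)
  triv_mem : MemTrivializationAtlas triv
  K : Set M
  isCompact : IsCompact K
  subset : K ⊆ chart.source ∩ triv.baseSet
  order : ℕ

attribute [instance] SeminormIndex.triv_mem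

namespace SeminormIndex

variable [IsManifold 𝓘(ℝ, H) ∞ M] [SmoothVectorBundle 𝕜 H F E]

variable (i : SeminormIndex H F E)

theorem map_mem (x : i.K) : i.chart x ∈ localDomain i.chart i.triv :=
  ⟨i.chart.map_source (i.subset x.2).1, by
    rw [mem_preimage, i.chart.left_inv (i.subset x.2).1]; exact (i.subset x.2).2⟩

theorem bddAbove (s : SmoothSection 𝕜 H F E) :
    BddAbove (range fun x : i.K => ‖iteratedFDerivWithin ℝ i.order
      (localRep i.chart i.triv s) (localDomain i.chart i.triv) (i.chart x)‖) := by
  have hc : ContinuousOn (fun x : M => ‖iteratedFDerivWithin ℝ i.order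
      (localRep i.chart i.triv s) (localDomain i.chart i.triv) (i.chart x)‖) i.K := by
    refine ContinuousOn.norm ?_
    refine ((contDiffOn_localRep i.chart_mem i.triv s).continuousOn_iteratedFDerivWithin
      (m := i.order) (by exact_mod_cast le_top)
      (isOpen_localDomain i.chart i.triv).uniqueDiffOn).comp
      (i.chart.continuousOn.mono fun x hx => (i.subset hx).1) fun x hx => i.map_mem ⟨x, hx⟩
  have := i.isCompact.bddAbove_image hc
  rwa [image_eq_range] at this

/-- The seminorm `p(s) = sup_{y ∈ φ(K)} ‖D^k s_{U,V}(y)‖` on `Γ(E)`. -/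
def toSeminorm : Seminorm 𝕜 (SmoothSection 𝕜 H F E) :=
  Seminorm.of (fun s => ⨆ x : i.K, ‖iteratedFDerivWithin ℝ i.order
      (localRep i.chart i.triv s) (localDomain i.chart i.triv) (i.chart x)‖)
    (by
      intro s t
      refine Real.iSup_le (fun x => ?_) (add_nonneg (Real.iSup_nonneg fun _ => norm_nonneg _)
        (Real.iSup_nonneg fun _ => norm_nonneg _))
      have hx := i.map_mem x
      have hu := (isOpen_localDomain i.chart i.triv).uniqueDiffOn (𝕜 := ℝ)
      rw [iteratedFDerivWithin_congr (localRep_add i.chart i.triv s t) hx,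
        iteratedFDerivWithin_add_apply
          (((contDiffOn_localRep i.chart_mem i.triv s).of_le (by exact_mod_cast le_top)) _ hx)
          (((contDiffOn_localRep i.chart_mem i.triv t).of_le (by exact_mod_cast le_top)) _ hx)
          hu hx]
      exact (norm_add_le _ _).trans
        (add_le_add (le_ciSup (i.bddAbove s) x) (le_ciSup (i.bddAbove t) x)))
    (by
      intro c s
      rw [Real.mul_iSup_of_nonneg (norm_nonneg c)]
      refine iSup_congr fun x => ?_
      have hx := i.map_mem x
      have hu := (isOpen_localDomain i.chart i.triv).uniqueDiffOn (𝕜 := ℝ)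
      rw [iteratedFDerivWithin_congr (localRep_const_smul i.chart i.triv c s) hx,
        iteratedFDerivWithin_const_smul_apply
          (((contDiffOn_localRep i.chart_mem i.triv s).of_le (by exact_mod_cast le_top)) _ hx)
          hu hx, norm_smul])

end SeminormIndex

variable [IsManifold 𝓘(ℝ, H) ∞ M] [SmoothVectorBundle 𝕜 H F E]

variable (𝕜 H F E) in
/-- The family of seminorms defining the topology of `Γ(E)`. -/
def seminormFamily : SeminormFamily 𝕜 (SmoothSection 𝕜 H F E) (SeminormIndex H F E) :=
  fun i => i.toSeminorm

/-- The Fréchet topology of `Γ(E)`, given by uniform convergence of all derivatives of local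
representations on compact sets. -/
instance : TopologicalSpace (SmoothSection 𝕜 H F E) :=
  (seminormFamily 𝕜 H F E).moduleFilterBasis.topology

theorem withSeminorms : WithSeminorms (seminormFamily 𝕜 H F E) := ⟨rfl⟩

variable (F E) in
theorem continuous_const_smul (f : SmoothFunction 𝕜 H M) :
    Continuous (fun s : SmoothSection 𝕜 H F E => f • s) := by
  let L : SmoothSection 𝕜 H F E →ₗ[𝕜] SmoothSection 𝕜 H F E :=
    Algebra.lsmul 𝕜 𝕜 (SmoothSection 𝕜 H F E) f
  have := (withSeminorms (𝕜 := 𝕜) (H := H) (F := F) (E := E)).topologicalAddGroup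
  change Continuous L
  refine WithSeminorms.continuous_of_continuous_comp withSeminorms L fun i => ?_
  have hu := (isOpen_localDomain i.chart i.triv).uniqueDiffOn (𝕜 := ℝ)
  have hf : ContDiffOn ℝ ∞ (fun y => f.1 (i.chart.symm y)) (localDomain i.chart i.triv) := by
    rw [← contMDiffOn_iff_contDiffOn]
    exact (ContMDiff.comp_contMDiffOn f.2 (contMDiffOn_symm_of_mem_maximalAtlas
      (IsManifold.subset_maximalAtlas i.chart_mem))).mono inter_subset_left
  have hC : ∀ j : ℕ, ∃ C : NNReal, ∀ x : i.K, ‖iteratedFDerivWithin ℝ j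
      (fun y => f.1 (i.chart.symm y)) (localDomain i.chart i.triv) (i.chart x)‖ ≤ C := by
    intro j
    have hc : ContinuousOn (fun x : M => iteratedFDerivWithin ℝ j
        (fun y => f.1 (i.chart.symm y)) (localDomain i.chart i.triv) (i.chart x)) i.K :=
      (hf.continuousOn_iteratedFDerivWithin (m := j) (by exact_mod_cast le_top) hu).comp
        (i.chart.continuousOn.mono fun x hx => (i.subset hx).1) fun x hx => i.map_mem ⟨x, hx⟩
    obtain ⟨C, hC⟩ := i.isCompact.exists_bound_of_continuousOn hc
    exact ⟨C.toNNReal, fun x => (hC x x.2).trans (Real.le_coe_toNNReal C)⟩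
  choose C hC using hC
  let q : ℕ → Seminorm 𝕜 (SmoothSection 𝕜 H F E) := fun j =>
    seminormFamily 𝕜 H F E { i with order := i.order - j }
  have hq : ∀ j, Continuous (q j) := fun j => withSeminorms.continuous_seminorm _
  refine Seminorm.continuous_of_le (q := ∑ j ∈ Finset.range (i.order + 1),
    ((i.order.choose j : NNReal) * C j) • q j) ?_ ?_
  · change Continuous fun s => (∑ j ∈ Finset.range (i.order + 1),
      ((i.order.choose j : NNReal) * C j) • q j) s
    simp only [sum_apply, smul_apply]
    exact continuous_finsetSum _ fun j _ => (hq j).const_smul _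
  · intro s
    rw [sum_apply]
    refine Real.iSup_le (fun x => ?_) (Finset.sum_nonneg fun _ _ => apply_nonneg _ _)
    have hx := i.map_mem x
    change ‖iteratedFDerivWithin ℝ i.order (localRep i.chart i.triv
      (f • s : SmoothSection 𝕜 H F E)) (localDomain i.chart i.triv) (i.chart x)‖ ≤ _
    rw [iteratedFDerivWithin_congr (localRep_smul i.chart i.triv f s) hx]
    refine (norm_iteratedFDerivWithin_smul_le hf (contDiffOn_localRep i.chart_mem i.triv s) hu hx
      (by exact_mod_cast le_top)).trans (Finset.sum_le_sum fun j _ => ?_)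
    have h1 : ‖iteratedFDerivWithin ℝ (i.order - j) (localRep i.chart i.triv s)
        (localDomain i.chart i.triv) (i.chart x)‖ ≤ q j s :=
      le_ciSup (SeminormIndex.bddAbove { i with order := i.order - j } s) x
    change _ ≤ ((i.order.choose j : NNReal) * C j : NNReal) * q j s
    push_cast
    gcongr
    exact hC j x

/-- The support of a section. -/
def support (s : ∀ x, E x) : Set M := closure {x | s x ≠ 0}

theorem support_smul_subset (f : SmoothFunction 𝕜 H M) (s : SmoothSection 𝕜 H F E) :
    support (f • s : SmoothSection 𝕜 H F E) ⊆ support s :=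
  closure_mono fun x (hx : f.1 x • s x ≠ 0) (h : s x = 0) => hx (by rw [h, smul_zero])

end SmoothSection

variable [IsManifold 𝓘(ℝ, H) ∞ M] [SmoothVectorBundle 𝕜 H F E]

/-- The `C^∞(M)`-submodule of smooth sections with compact support. -/
def compactSectionSubmodule : Submodule (SmoothFunction 𝕜 H M) (SmoothSection 𝕜 H F E) where
  carrier := {s | IsCompact (SmoothSection.support s)}
  add_mem' := by
    intro s t hs ht
    refine (hs.union ht).of_isClosed_subset isClosed_closure ?_
    change closure {x : M | (s + t) x ≠ 0} ⊆ closure {x : M | s x ≠ 0} ∪ closure {x : M | t x ≠ 0}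
    rw [← closure_union]
    refine closure_mono fun x hx => ?_
    by_contra h
    rw [mem_union, not_or] at h
    have h1 : s x = 0 := not_not.1 h.1
    have h2 : t x = 0 := not_not.1 h.2
    exact hx (show s x + t x = 0 by rw [h1, h2, add_zero])
  zero_mem' := by
    have : {x : M | (0 : SmoothSection 𝕜 H F E) x ≠ 0} = ∅ :=
      eq_empty_of_forall_notMem fun x hx => hx rfl
    simp [SmoothSection.support, this]
  smul_mem' := by
    intro f s hs
    exact hs.of_isClosed_subset isClosed_closure (SmoothSection.support_smul_subset f s)

/-- The space `Γ_c(E)` of smooth sections with compact support. -/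
def CompactSection : Type _ := compactSectionSubmodule 𝕜 H F E

namespace CompactSection

instance : AddCommGroup (CompactSection 𝕜 H F E) :=
  inferInstanceAs (AddCommGroup (compactSectionSubmodule 𝕜 H F E))

instance : Module (SmoothFunction 𝕜 H M) (CompactSection 𝕜 H F E) :=
  inferInstanceAs (Module (SmoothFunction 𝕜 H M) (compactSectionSubmodule 𝕜 H F E))

instance : Module 𝕜 (CompactSection 𝕜 H F E) :=
  inferInstanceAs (Module 𝕜 (compactSectionSubmodule 𝕜 H F E))

instance : IsScalarTower 𝕜 (SmoothFunction 𝕜 H M) (CompactSection 𝕜 H F E) :=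
  inferInstanceAs (IsScalarTower 𝕜 (SmoothFunction 𝕜 H M) (compactSectionSubmodule 𝕜 H F E))

instance : CoeFun (CompactSection 𝕜 H F E) (fun _ => ∀ x, E x) := ⟨fun s => s.1.1⟩

/-- The Fréchet space `Γ_{c,L}(E)` of smooth sections with support in the compact set `L`, with the
subspace topology of `Γ(E)`. -/
abbrev SupportedIn (L : Set M) : Type _ :=
  {s : SmoothSection 𝕜 H F E // SmoothSection.support s ⊆ L}

/-- The inclusion `Γ_{c,L}(E) → Γ_c(E)`. -/
def ofSupportedIn {L : Set M} (hL : IsCompact L) (s : SupportedIn 𝕜 H F E L) :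
    CompactSection 𝕜 H F E :=
  ⟨s.1, hL.of_isClosed_subset isClosed_closure s.2⟩

/-- The (LF) topology of `Γ_c(E)`: the inductive limit of the spaces `Γ_{c,L}(E)`, i.e. the finest
locally convex topology for which all inclusions `Γ_{c,L}(E) → Γ_c(E)`, `L` compact, are
continuous. -/
instance : TopologicalSpace (CompactSection 𝕜 H F E) :=
  finestLocallyConvex 𝕜 (CompactSection 𝕜 H F E) fun t =>
    ∀ (L : Set M) (hL : IsCompact L), Continuous[inferInstance, t] (ofSupportedIn 𝕜 H F E hL)

theorem continuous_const_smul (f : SmoothFunction 𝕜 H M) :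
    Continuous (fun s : CompactSection 𝕜 H F E => f • s) := by
  let L : CompactSection 𝕜 H F E →ₗ[𝕜] CompactSection 𝕜 H F E :=
    Algebra.lsmul 𝕜 𝕜 (CompactSection 𝕜 H F E) f
  have hP : PolynormableSpace 𝕜 (CompactSection 𝕜 H F E) := polynormable_finestLocallyConvex _ _ _
  change Continuous L
  rw [continuous_iff_le_induced]
  refine sInf_le ⟨PolynormableSpace.induced L, fun K hK => ?_⟩
  rw [continuous_induced_rng]
  have hincl : Continuous (ofSupportedIn 𝕜 H F E hK) :=
    continuous_sInf_rng.2 fun t ht => ht.2 K hK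
  have hm : Continuous (fun s : SupportedIn 𝕜 H F E K => (⟨f • s.1,
      subset_trans (SmoothSection.support_smul_subset f s.1) s.2⟩ : SupportedIn 𝕜 H F E K)) :=
    ((SmoothSection.continuous_const_smul F E f).comp continuous_subtype_val).subtype_mk _
  exact hincl.comp hm

instance : BoundedConstSMul 𝕜 (SmoothFunction 𝕜 H M) (CompactSection 𝕜 H F E) where
  isBoundedMap_smul f _ hB :=
    hB.image (⟨Algebra.lsmul 𝕜 𝕜 (CompactSection 𝕜 H F E) f, continuous_const_smul 𝕜 H F E f⟩ :
      CompactSection 𝕜 H F E →L[𝕜] CompactSection 𝕜 H F E)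

end CompactSection

end Sections

/-! ### The tensor product of two vector bundles -/

section TensorBundle

variable (𝕜 : Type*) [RCLike 𝕜]

section Model

variable (F₁ F₂ : Type*)
  [NormedAddCommGroup F₁] [NormedSpace 𝕜 F₁] [NormedSpace ℝ F₁] [IsScalarTower ℝ 𝕜 F₁]
  [NormedAddCommGroup F₂] [NormedSpace 𝕜 F₂]

/-- The typical fibre `F₁ ⊗ F₂` of a tensor product bundle, as a finite-dimensional normed space. -/
def TensorFibre : Type _ := F₁ ⊗[𝕜] F₂

namespace TensorFibre

instance : AddCommGroup (TensorFibre 𝕜 F₁ F₂) := inferInstanceAs (AddCommGroup (F₁ ⊗[𝕜] F₂))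

instance : Module 𝕜 (TensorFibre 𝕜 F₁ F₂) := inferInstanceAs (Module 𝕜 (F₁ ⊗[𝕜] F₂))

instance : Module ℝ (TensorFibre 𝕜 F₁ F₂) := inferInstanceAs (Module ℝ (F₁ ⊗[𝕜] F₂))

instance : IsScalarTower ℝ 𝕜 (TensorFibre 𝕜 F₁ F₂) :=
  inferInstanceAs (IsScalarTower ℝ 𝕜 (F₁ ⊗[𝕜] F₂))

variable [FiniteDimensional 𝕜 F₁] [FiniteDimensional 𝕜 F₂]

instance : FiniteDimensional 𝕜 (TensorFibre 𝕜 F₁ F₂) :=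
  inferInstanceAs (FiniteDimensional 𝕜 (F₁ ⊗[𝕜] F₂))

/-- A norm on the finite-dimensional space `F₁ ⊗ F₂` (all norms being equivalent): the maximum norm
of the coordinates in some basis. -/
instance : NormedAddCommGroup (TensorFibre 𝕜 F₁ F₂) :=
  NormedAddCommGroup.induced _ _ (Module.finBasis 𝕜 (TensorFibre 𝕜 F₁ F₂)).equivFun.toLinearMap
    (Module.finBasis 𝕜 (TensorFibre 𝕜 F₁ F₂)).equivFun.injective

instance : NormedSpace 𝕜 (TensorFibre 𝕜 F₁ F₂) :=
  NormedSpace.induced 𝕜 _ _ (Module.finBasis 𝕜 (TensorFibre 𝕜 F₁ F₂)).equivFun.toLinearMap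

instance : NormedSpace ℝ (TensorFibre 𝕜 F₁ F₂) where
  norm_smul_le r z := by
    rw [← algebraMap_smul 𝕜 r z, norm_smul, norm_algebraMap']

end TensorFibre

end Model

variable {H M : Type*} [NormedAddCommGroup H] [NormedSpace ℝ H]
  [TopologicalSpace M] [ChartedSpace H M]
  (F₁ : Type*) [NormedAddCommGroup F₁] [NormedSpace 𝕜 F₁] [NormedSpace ℝ F₁] [IsScalarTower ℝ 𝕜 F₁]
  [FiniteDimensional 𝕜 F₁]
  (E₁ : M → Type*) [TopologicalSpace (TotalSpace F₁ E₁)]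
  [∀ x, AddCommGroup (E₁ x)] [∀ x, Module 𝕜 (E₁ x)] [∀ x, TopologicalSpace (E₁ x)]
  [FiberBundle F₁ E₁] [VectorBundle 𝕜 F₁ E₁]
  (F₂ : Type*) [NormedAddCommGroup F₂] [NormedSpace 𝕜 F₂] [NormedSpace ℝ F₂] [IsScalarTower ℝ 𝕜 F₂]
  [FiniteDimensional 𝕜 F₂]
  (E₂ : M → Type*) [TopologicalSpace (TotalSpace F₂ E₂)]
  [∀ x, AddCommGroup (E₂ x)] [∀ x, Module 𝕜 (E₂ x)] [∀ x, TopologicalSpace (E₂ x)]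
  [FiberBundle F₂ E₂] [VectorBundle 𝕜 F₂ E₂]

/-- The fibres `E₁ x ⊗ E₂ x` of the tensor product bundle `E₁ ⊗ E₂`. -/
def TensorBundle {M : Type*} (E₁ : M → Type*) [∀ x, AddCommGroup (E₁ x)] [∀ x, Module 𝕜 (E₁ x)]
    (E₂ : M → Type*) [∀ x, AddCommGroup (E₂ x)] [∀ x, Module 𝕜 (E₂ x)] (x : M) : Type _ :=
  E₁ x ⊗[𝕜] E₂ x

namespace TensorBundle

instance (x : M) : AddCommGroup (TensorBundle 𝕜 E₁ E₂ x) :=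
  inferInstanceAs (AddCommGroup (E₁ x ⊗[𝕜] E₂ x))

instance (x : M) : Module 𝕜 (TensorBundle 𝕜 E₁ E₂ x) :=
  inferInstanceAs (Module 𝕜 (E₁ x ⊗[𝕜] E₂ x))

/-- The canonical topology of the finite-dimensional vector space `E₁ x ⊗ E₂ x`. -/
instance (x : M) : TopologicalSpace (TensorBundle 𝕜 E₁ E₂ x) :=
  moduleTopology 𝕜 (TensorBundle 𝕜 E₁ E₂ x)

instance (x : M) : IsModuleTopology 𝕜 (TensorBundle 𝕜 E₁ E₂ x) := ⟨rfl⟩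

variable {E₁ E₂} in
/-- The element `v ⊗ w` of the fibre of `E₁ ⊗ E₂` at `x`. -/
def tmul {x : M} (v : E₁ x) (w : E₂ x) : TensorBundle 𝕜 E₁ E₂ x := v ⊗ₜ[𝕜] w

section Pretrivialization

variable {F₁ E₁ F₂ E₂}
variable (e₁ : Trivialization F₁ (π F₁ E₁)) (e₂ : Trivialization F₂ (π F₂ E₂))
  [e₁.IsLinear 𝕜] [e₂.IsLinear 𝕜]

/-- The map `(e₁)_x ⊗ (e₂)_x : E₁ x ⊗ E₂ x → F₁ ⊗ F₂`. -/
def fibreMap (x : M) : TensorBundle 𝕜 E₁ E₂ x →ₗ[𝕜] TensorFibre 𝕜 F₁ F₂ :=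
  TensorProduct.map (e₁.linearMapAt 𝕜 x) (e₂.linearMapAt 𝕜 x)

/-- The map `(e₁)_x⁻¹ ⊗ (e₂)_x⁻¹ : F₁ ⊗ F₂ → E₁ x ⊗ E₂ x`. -/
def fibreMapSymm (x : M) : TensorFibre 𝕜 F₁ F₂ →ₗ[𝕜] TensorBundle 𝕜 E₁ E₂ x :=
  TensorProduct.map (e₁.symmₗ 𝕜 x) (e₂.symmₗ 𝕜 x)

theorem fibreMapSymm_fibreMap {x : M} (hx : x ∈ e₁.baseSet ∩ e₂.baseSet)
    (z : TensorBundle 𝕜 E₁ E₂ x) :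
    fibreMapSymm 𝕜 e₁ e₂ x (fibreMap 𝕜 e₁ e₂ x z) = z := by
  have h1 : (e₁.symmₗ 𝕜 x).comp (e₁.linearMapAt 𝕜 x) = LinearMap.id :=
    LinearMap.ext fun v => e₁.symmₗ_linearMapAt hx.1 v
  have h2 : (e₂.symmₗ 𝕜 x).comp (e₂.linearMapAt 𝕜 x) = LinearMap.id :=
    LinearMap.ext fun v => e₂.symmₗ_linearMapAt hx.2 v
  change ((TensorProduct.map (e₁.symmₗ 𝕜 x) (e₂.symmₗ 𝕜 x)).comp
    (TensorProduct.map (e₁.linearMapAt 𝕜 x) (e₂.linearMapAt 𝕜 x))) z = z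
  rw [← TensorProduct.map_comp, h1, h2, TensorProduct.map_id]
  rfl

theorem fibreMap_fibreMapSymm {x : M} (hx : x ∈ e₁.baseSet ∩ e₂.baseSet)
    (z : TensorFibre 𝕜 F₁ F₂) :
    fibreMap 𝕜 e₁ e₂ x (fibreMapSymm 𝕜 e₁ e₂ x z) = z := by
  have h1 : (e₁.linearMapAt 𝕜 x).comp (e₁.symmₗ 𝕜 x) = LinearMap.id :=
    LinearMap.ext fun v => e₁.linearMapAt_symmₗ hx.1 v
  have h2 : (e₂.linearMapAt 𝕜 x).comp (e₂.symmₗ 𝕜 x) = LinearMap.id :=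
    LinearMap.ext fun v => e₂.linearMapAt_symmₗ hx.2 v
  change ((TensorProduct.map (e₁.linearMapAt 𝕜 x) (e₂.linearMapAt 𝕜 x)).comp
    (TensorProduct.map (e₁.symmₗ 𝕜 x) (e₂.symmₗ 𝕜 x))) z = z
  rw [← TensorProduct.map_comp, h1, h2, TensorProduct.map_id]
  rfl

/-- The (pre)trivialization `e₁ ⊗ e₂` of `E₁ ⊗ E₂` over `V₁ ∩ V₂` induced by local trivializations
`e₁` over `V₁` and `e₂` over `V₂`. -/
def pretrivialization :
    Pretrivialization (TensorFibre 𝕜 F₁ F₂)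
      (π (TensorFibre 𝕜 F₁ F₂) (TensorBundle 𝕜 E₁ E₂)) where
  toFun p := ⟨p.1, fibreMap 𝕜 e₁ e₂ p.1 p.2⟩
  invFun p := ⟨p.1, fibreMapSymm 𝕜 e₁ e₂ p.1 p.2⟩
  source := TotalSpace.proj ⁻¹' (e₁.baseSet ∩ e₂.baseSet)
  target := (e₁.baseSet ∩ e₂.baseSet) ×ˢ Set.univ
  map_source' := fun ⟨_, _⟩ h ↦ ⟨h, Set.mem_univ _⟩
  map_target' := fun ⟨_, _⟩ h ↦ h.1
  left_inv' := fun ⟨x, z⟩ hx ↦ by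
    dsimp only
    rw [fibreMapSymm_fibreMap 𝕜 e₁ e₂ hx]
  right_inv' := fun ⟨x, z⟩ ⟨hx, _⟩ ↦ by
    dsimp only
    rw [fibreMap_fibreMapSymm 𝕜 e₁ e₂ hx]
  open_target := (e₁.open_baseSet.inter e₂.open_baseSet).prod isOpen_univ
  baseSet := e₁.baseSet ∩ e₂.baseSet
  open_baseSet := e₁.open_baseSet.inter e₂.open_baseSet
  source_eq := rfl
  target_eq := rfl
  proj_toFun _ _ := rfl

instance : (pretrivialization 𝕜 e₁ e₂).IsLinear 𝕜 where
  linear x _ := ⟨map_add (fibreMap 𝕜 e₁ e₂ x), map_smul (fibreMap 𝕜 e₁ e₂ x)⟩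

variable (F₁ F₂) in
/-- The bilinear map `(S, T) ↦ S ⊗ T` on endomorphisms of the typical fibres. -/
def mapL : (F₁ →L[𝕜] F₁) →ₗ[𝕜] (F₂ →L[𝕜] F₂) →ₗ[𝕜]
    (TensorFibre 𝕜 F₁ F₂ →L[𝕜] TensorFibre 𝕜 F₁ F₂) :=
  LinearMap.mk₂ 𝕜
    (fun S T => LinearMap.toContinuousLinearMap
      (show TensorFibre 𝕜 F₁ F₂ →ₗ[𝕜] TensorFibre 𝕜 F₁ F₂ from
        TensorProduct.map (S : F₁ →ₗ[𝕜] F₁) (T : F₂ →ₗ[𝕜] F₂)))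
    (fun S S' T => ContinuousLinearMap.ext fun z =>
      DFunLike.congr_fun (TensorProduct.map_add_left (S : F₁ →ₗ[𝕜] F₁) (S' : F₁ →ₗ[𝕜] F₁)
        (T : F₂ →ₗ[𝕜] F₂)) z)
    (fun c S T => ContinuousLinearMap.ext fun z =>
      DFunLike.congr_fun (TensorProduct.map_smul_left c (S : F₁ →ₗ[𝕜] F₁)
        (T : F₂ →ₗ[𝕜] F₂)) z)
    (fun S T T' => ContinuousLinearMap.ext fun z =>
      DFunLike.congr_fun (TensorProduct.map_add_right (S : F₁ →ₗ[𝕜] F₁) (T : F₂ →ₗ[𝕜] F₂)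
        (T' : F₂ →ₗ[𝕜] F₂)) z)
    (fun c S T => ContinuousLinearMap.ext fun z =>
      DFunLike.congr_fun (TensorProduct.map_smul_right c (S : F₁ →ₗ[𝕜] F₁)
        (T : F₂ →ₗ[𝕜] F₂)) z)

theorem contDiff_mapL :
    ContDiff ℝ ∞ fun p : (F₁ →L[𝕜] F₁) × (F₂ →L[𝕜] F₂) => mapL 𝕜 F₁ F₂ p.1 p.2 := by
  let B : (F₁ →L[𝕜] F₁) →L[𝕜] (F₂ →L[𝕜] F₂) →L[𝕜]
      (TensorFibre 𝕜 F₁ F₂ →L[𝕜] TensorFibre 𝕜 F₁ F₂) :=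
    LinearMap.toContinuousLinearMap
      (((LinearMap.toContinuousLinearMap (𝕜 := 𝕜) (E := F₂ →L[𝕜] F₂)
        (F' := TensorFibre 𝕜 F₁ F₂ →L[𝕜] TensorFibre 𝕜 F₁ F₂)).toLinearMap).comp (mapL 𝕜 F₁ F₂))
  have hB : IsBoundedBilinearMap ℝ
      fun p : (F₁ →L[𝕜] F₁) × (F₂ →L[𝕜] F₂) => mapL 𝕜 F₁ F₂ p.1 p.2 :=
    { add_left := fun S S' T => by rw [map_add, LinearMap.add_apply]
      smul_left := fun c S T => by
        rw [← algebraMap_smul 𝕜 c S, map_smul, LinearMap.smul_apply, algebraMap_smul]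
      add_right := fun S T T' => by rw [map_add]
      smul_right := fun c S T => by
        rw [← algebraMap_smul 𝕜 c T, map_smul, algebraMap_smul]
      bound := B.isBoundedBilinearMap.bound }
  exact hB.contDiff

variable (e₁' : Trivialization F₁ (π F₁ E₁)) (e₂' : Trivialization F₂ (π F₂ E₂))
  [e₁'.IsLinear 𝕜] [e₂'.IsLinear 𝕜]

/-- The transition functions of `E₁ ⊗ E₂`. -/
def coordChange (b : M) : TensorFibre 𝕜 F₁ F₂ →L[𝕜] TensorFibre 𝕜 F₁ F₂ :=
  mapL 𝕜 F₁ F₂ (e₁.coordChangeL 𝕜 e₁' b : F₁ →L[𝕜] F₁) (e₂.coordChangeL 𝕜 e₂' b : F₂ →L[𝕜] F₂)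

theorem coordChange_apply (b : M)
    (hb : b ∈ e₁.baseSet ∩ e₂.baseSet ∩ (e₁'.baseSet ∩ e₂'.baseSet)) (z : TensorFibre 𝕜 F₁ F₂) :
    coordChange 𝕜 e₁ e₂ e₁' e₂' b z =
      (pretrivialization 𝕜 e₁' e₂' ⟨b, (pretrivialization 𝕜 e₁ e₂).symm b z⟩).2 := by
  have hs : (pretrivialization 𝕜 e₁ e₂).symm b z = fibreMapSymm 𝕜 e₁ e₂ b z := by
    rw [Pretrivialization.symm_apply _ hb.1]
    rfl
  rw [hs]
  have h1 : ((e₁.coordChangeL 𝕜 e₁' b : F₁ →L[𝕜] F₁) : F₁ →ₗ[𝕜] F₁) =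
      (e₁'.linearMapAt 𝕜 b).comp (e₁.symmₗ 𝕜 b) := by
    ext v
    change e₁.coordChangeL 𝕜 e₁' b v = e₁'.linearMapAt 𝕜 b (e₁.symmₗ 𝕜 b v)
    rw [Trivialization.coordChangeL_apply _ _ ⟨hb.1.1, hb.2.1⟩,
      Trivialization.linearMapAt_apply, if_pos hb.2.1, Trivialization.coe_symmₗ _ hb.1.1]
  have h2 : ((e₂.coordChangeL 𝕜 e₂' b : F₂ →L[𝕜] F₂) : F₂ →ₗ[𝕜] F₂) =
      (e₂'.linearMapAt 𝕜 b).comp (e₂.symmₗ 𝕜 b) := by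
    ext v
    change e₂.coordChangeL 𝕜 e₂' b v = e₂'.linearMapAt 𝕜 b (e₂.symmₗ 𝕜 b v)
    rw [Trivialization.coordChangeL_apply _ _ ⟨hb.1.2, hb.2.2⟩,
      Trivialization.linearMapAt_apply, if_pos hb.2.2, Trivialization.coe_symmₗ _ hb.1.2]
  change TensorProduct.map ((e₁.coordChangeL 𝕜 e₁' b : F₁ →L[𝕜] F₁) : F₁ →ₗ[𝕜] F₁)
    ((e₂.coordChangeL 𝕜 e₂' b : F₂ →L[𝕜] F₂) : F₂ →ₗ[𝕜] F₂) z =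
    (TensorProduct.map (e₁'.linearMapAt 𝕜 b) (e₂'.linearMapAt 𝕜 b))
      (TensorProduct.map (e₁.symmₗ 𝕜 b) (e₂.symmₗ 𝕜 b) z)
  rw [h1, h2, TensorProduct.map_comp]
  rfl

theorem continuousOn_coordChange [MemTrivializationAtlas e₁] [MemTrivializationAtlas e₂]
    [MemTrivializationAtlas e₁'] [MemTrivializationAtlas e₂'] :
    ContinuousOn (coordChange 𝕜 e₁ e₂ e₁' e₂')
      (e₁.baseSet ∩ e₂.baseSet ∩ (e₁'.baseSet ∩ e₂'.baseSet)) := by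
  have h1 : ContinuousOn (fun b => (e₁.coordChangeL 𝕜 e₁' b : F₁ →L[𝕜] F₁))
      (e₁.baseSet ∩ e₂.baseSet ∩ (e₁'.baseSet ∩ e₂'.baseSet)) :=
    (_root_.continuousOn_coordChange 𝕜 e₁ e₁').mono fun _ h => ⟨h.1.1, h.2.1⟩
  have h2 : ContinuousOn (fun b => (e₂.coordChangeL 𝕜 e₂' b : F₂ →L[𝕜] F₂))
      (e₁.baseSet ∩ e₂.baseSet ∩ (e₁'.baseSet ∩ e₂'.baseSet)) :=
    (_root_.continuousOn_coordChange 𝕜 e₂ e₂').mono fun _ h => ⟨h.1.2, h.2.2⟩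
  have h3 := (contDiff_mapL 𝕜 (F₁ := F₁) (F₂ := F₂)).continuous.comp_continuousOn (h1.prodMk h2)
  have h4 : coordChange 𝕜 e₁ e₂ e₁' e₂' =
      (fun p : (F₁ →L[𝕜] F₁) × (F₂ →L[𝕜] F₂) => mapL 𝕜 F₁ F₂ p.1 p.2) ∘
        (fun b => ((e₁.coordChangeL 𝕜 e₁' b : F₁ →L[𝕜] F₁),
          (e₂.coordChangeL 𝕜 e₂' b : F₂ →L[𝕜] F₂))) := rfl
  rw [h4]
  exact h3

theorem contMDiffOn_coordChange [SmoothVectorBundle 𝕜 H F₁ E₁] [SmoothVectorBundle 𝕜 H F₂ E₂]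
    [MemTrivializationAtlas e₁] [MemTrivializationAtlas e₂]
    [MemTrivializationAtlas e₁'] [MemTrivializationAtlas e₂'] :
    ContMDiffOn 𝓘(ℝ, H) 𝓘(ℝ, TensorFibre 𝕜 F₁ F₂ →L[𝕜] TensorFibre 𝕜 F₁ F₂) ∞
      (coordChange 𝕜 e₁ e₂ e₁' e₂')
      (e₁.baseSet ∩ e₂.baseSet ∩ (e₁'.baseSet ∩ e₂'.baseSet)) := by
  have h1 : ContMDiffOn 𝓘(ℝ, H) 𝓘(ℝ, F₁ →L[𝕜] F₁) ∞
      (fun b => (e₁.coordChangeL 𝕜 e₁' b : F₁ →L[𝕜] F₁))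
      (e₁.baseSet ∩ e₂.baseSet ∩ (e₁'.baseSet ∩ e₂'.baseSet)) :=
    (SmoothVectorBundle.contMDiffOn_coordChangeL e₁ e₁').mono fun _ h => ⟨h.1.1, h.2.1⟩
  have h2 : ContMDiffOn 𝓘(ℝ, H) 𝓘(ℝ, F₂ →L[𝕜] F₂) ∞
      (fun b => (e₂.coordChangeL 𝕜 e₂' b : F₂ →L[𝕜] F₂))
      (e₁.baseSet ∩ e₂.baseSet ∩ (e₁'.baseSet ∩ e₂'.baseSet)) :=
    (SmoothVectorBundle.contMDiffOn_coordChangeL e₂ e₂').mono fun _ h => ⟨h.1.2, h.2.2⟩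
  have h3 := (contDiff_mapL 𝕜 (F₁ := F₁) (F₂ := F₂)).contMDiff.comp_contMDiffOn
    (h1.prodMk_space h2)
  have h4 : coordChange 𝕜 e₁ e₂ e₁' e₂' =
      (fun p : (F₁ →L[𝕜] F₁) × (F₂ →L[𝕜] F₂) => mapL 𝕜 F₁ F₂ p.1 p.2) ∘
        (fun b => ((e₁.coordChangeL 𝕜 e₁' b : F₁ →L[𝕜] F₁),
          (e₂.coordChangeL 𝕜 e₂' b : F₂ →L[𝕜] F₂))) := rfl
  rw [h4]
  exact h3

end Pretrivialization

/-- The tensor product bundle `E₁ ⊗ E₂`, given by its local trivializations `e₁ ⊗ e₂` with `e₁`,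
`e₂` in the trivializing atlases of `E₁`, `E₂`. -/
def vectorPrebundle : VectorPrebundle 𝕜 (TensorFibre 𝕜 F₁ F₂) (TensorBundle 𝕜 E₁ E₂) where
  pretrivializationAtlas :=
    {e | ∃ (e₁ : Trivialization F₁ (π F₁ E₁)) (e₂ : Trivialization F₂ (π F₂ E₂))
      (_ : MemTrivializationAtlas e₁) (_ : MemTrivializationAtlas e₂),
        e = pretrivialization 𝕜 e₁ e₂}
  pretrivialization_linear' := by
    rintro _ ⟨e₁, e₂, he₁, he₂, rfl⟩
    infer_instance
  pretrivializationAt x :=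
    pretrivialization 𝕜 (trivializationAt F₁ E₁ x) (trivializationAt F₂ E₂ x)
  mem_base_pretrivializationAt x :=
    ⟨mem_baseSet_trivializationAt F₁ E₁ x, mem_baseSet_trivializationAt F₂ E₂ x⟩
  pretrivialization_mem_atlas x :=
    ⟨trivializationAt F₁ E₁ x, trivializationAt F₂ E₂ x, inferInstance, inferInstance, rfl⟩
  exists_coordChange := by
    rintro _ ⟨e₁, e₂, he₁, he₂, rfl⟩ _ ⟨e₁', e₂', he₁', he₂', rfl⟩
    exact ⟨coordChange 𝕜 e₁ e₂ e₁' e₂', continuousOn_coordChange 𝕜 e₁ e₂ e₁' e₂',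
      coordChange_apply 𝕜 e₁ e₂ e₁' e₂'⟩
  totalSpaceMk_isInducing := by
    intro b
    have : IsModuleTopology 𝕜 (TensorFibre 𝕜 F₁ F₂) := isModuleTopologyOfFiniteDimensional
    have := IsModuleTopology.toContinuousAdd 𝕜 (TensorBundle 𝕜 E₁ E₂ b)
    let e₁ := trivializationAt F₁ E₁ b
    let e₂ := trivializationAt F₂ E₂ b
    have hb : b ∈ e₁.baseSet ∩ e₂.baseSet :=
      ⟨mem_baseSet_trivializationAt F₁ E₁ b, mem_baseSet_trivializationAt F₂ E₂ b⟩
    have h : IsInducing (fibreMap 𝕜 e₁ e₂ b) :=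
      IsInducing.of_comp (g := fibreMapSymm 𝕜 e₁ e₂ b)
        (IsModuleTopology.continuous_of_linearMap _) (IsModuleTopology.continuous_of_linearMap _)
        (by
          have : fibreMapSymm 𝕜 e₁ e₂ b ∘ fibreMap 𝕜 e₁ e₂ b = id :=
            funext fun z => fibreMapSymm_fibreMap 𝕜 e₁ e₂ hb z
          rw [this]
          exact IsInducing.id)
    exact isInducing_const_prod.mpr h

instance : TopologicalSpace (TotalSpace (TensorFibre 𝕜 F₁ F₂) (TensorBundle 𝕜 E₁ E₂)) :=
  (vectorPrebundle 𝕜 F₁ E₁ F₂ E₂).totalSpaceTopology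

instance : FiberBundle (TensorFibre 𝕜 F₁ F₂) (TensorBundle 𝕜 E₁ E₂) :=
  (vectorPrebundle 𝕜 F₁ E₁ F₂ E₂).toFiberBundle

instance : VectorBundle 𝕜 (TensorFibre 𝕜 F₁ F₂) (TensorBundle 𝕜 E₁ E₂) :=
  (vectorPrebundle 𝕜 F₁ E₁ F₂ E₂).toVectorBundle

instance [SmoothVectorBundle 𝕜 H F₁ E₁] [SmoothVectorBundle 𝕜 H F₂ E₂] :
    SmoothVectorBundle 𝕜 H (TensorFibre 𝕜 F₁ F₂) (TensorBundle 𝕜 E₁ E₂) where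
  contMDiffOn_coordChangeL := by
    rintro _ _ ⟨_, ⟨e₁, e₂, he₁, he₂, rfl⟩, rfl⟩ ⟨_, ⟨e₁', e₂', he₁', he₂', rfl⟩, rfl⟩
    refine (contMDiffOn_coordChange (H := H) 𝕜 e₁ e₂ e₁' e₂').congr fun b hb => ?_
    ext z
    rw [coordChange_apply 𝕜 e₁ e₂ e₁' e₂' b hb z, ContinuousLinearEquiv.coe_coe,
      Trivialization.coordChangeL_apply]
    exacts [rfl, hb]

end TensorBundle

end TensorBundle

end

noncomputable section

set_option linter.unusedSectionVars false

/-! The inverse of `Φ` can be written down with a locally finite frame of `F`. Cover `M` by domains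
of trivializations `e i` of `F`, take a partition of unity `ρ i` subordinate to them and smooth `χ
i`, supported in the same domains, with `χ i = 1` on the support of `ρ i`. For a basis `b` of the
typical fibre put `t (i, j) = χ i • (e i)⁻¹ (b j)`, a global section of `F`, and let `P (i, j) u` be
`ρ i` times the contraction of `u` with the coordinate form `b.coord j ∘ e i`. Since `∑ χ i ρ i = ∑
ρ i = 1`, every `u` in `Γ_c(E ⊗ F)` equals `∑ P k u ⊗ t k`, and the inverse is `Ψ u = ∑ [P k u ⊗ t
k]`.

Then `Φ ∘ Ψ = id` is the frame expansion in each fibre. For `Ψ ∘ Φ = id`, the contraction of `s ⊗ w`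
is `λ k • s` with a smooth function `λ k`. This factor moves across the tensor sign, leaving `[s ⊗ ∑
λ k • t k]`. The finite sum that remains agrees with `w` on a neighbourhood of the support of `s`,
and a cutoff function absorbs the difference.

Boundedness of `Φ` follows from the universal property and the Leibniz rule. For `Ψ` the decisive
fact is that a bounded subset of the (LF) space `Γ_c` has its supports in one compact set
(`CompactSection.exists_compact_of_isVonNBounded`). On such a set only finitely many `P k` are
nonzero, so `Ψ` is there a finite sum of bounded maps. The abstract half of the argument is
`BornologicalTensor.exists_linearEquiv`. -/

theorem IsBoundedMap.sum {𝕜 X Y κ : Type*} [NormedField 𝕜] [AddCommGroup X] [Module 𝕜 X]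
    [TopologicalSpace X] [AddCommGroup Y] [Module 𝕜 Y] [TopologicalSpace Y]
    [IsTopologicalAddGroup Y] [ContinuousSMul 𝕜 Y] {f : κ → X → Y}
    (hf : ∀ k, IsBoundedMap 𝕜 (f k)) (s : Finset κ) :
    IsBoundedMap 𝕜 fun x => ∑ k ∈ s, f k x := by
  classical
  intro B hB
  induction s using Finset.induction_on with
  | empty =>
    refine (Bornology.isVonNBounded_singleton (0 : Y)).subset ?_
    rintro _ ⟨x, -, rfl⟩
    simp
  | insert k s hk ih =>
    refine ((hf k B hB).add ih).subset ?_
    rintro _ ⟨x, hx, rfl⟩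
    simp only [Finset.sum_insert hk]
    exact Set.add_mem_add ⟨x, hx, rfl⟩ ⟨x, hx, rfl⟩

/-! ### Universal property of the bornological tensor product and a criterion for isomorphism -/

section BornologicalTensor

variable {𝕜 A M N : Type*} [RCLike 𝕜] [CommRing A] [Algebra 𝕜 A]
  [AddCommGroup M] [Module 𝕜 M] [Module A M] [IsScalarTower 𝕜 A M] [TopologicalSpace M]
  [AddCommGroup N] [Module 𝕜 N] [Module A N] [IsScalarTower 𝕜 A N] [TopologicalSpace N]

theorem Bornology.IsVonNBounded.prod {S : Set M} {T : Set N}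
    (hS : Bornology.IsVonNBounded 𝕜 S) (hT : Bornology.IsVonNBounded 𝕜 T) :
    Bornology.IsVonNBounded 𝕜 (S ×ˢ T) := by
  intro U hU
  rw [Prod.zero_eq_mk, nhds_prod_eq, Filter.mem_prod_iff] at hU
  obtain ⟨U₁, hU₁, U₂, hU₂, hU⟩ := hU
  have h1 := hS hU₁
  have h2 := hT hU₂
  rw [absorbs_iff_eventually_cobounded_mapsTo] at h1 h2 ⊢
  filter_upwards [h1, h2] with c hc₁ hc₂
  exact fun p hp => hU ⟨hc₁ hp.1, hc₂ hp.2⟩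

/-- The universal property of the bornological tensor product over `𝕜`: the linear map induced by
a bounded bilinear map into a locally convex space is continuous. -/
theorem continuous_of_isBoundedMap_tmul {G : Type*} [AddCommGroup G] [Module 𝕜 G]
    [TopologicalSpace G] [PolynormableSpace 𝕜 G] (L : M ⊗[𝕜] N →ₗ[𝕜] G)
    (hL : IsBoundedMap 𝕜 fun p : M × N => L (p.1 ⊗ₜ[𝕜] p.2)) :
    letI := bornologicalTensorTopology 𝕜 M N
    Continuous L := by
  let τ := bornologicalTensorTopology 𝕜 M N
  change Continuous L
  rw [continuous_iff_le_induced]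
  -- The topology induced by `L` is locally convex. Once `⊗` is shown to be bounded for it, it is
  -- one of the topologies over which the infimum is taken.
  refine sInf_le ⟨PolynormableSpace.induced L, ?_⟩
  intro B hB V hV
  rw [nhds_induced, map_zero] at hV
  obtain ⟨W, hW, hWV⟩ := hV
  have h2 := hL B hB hW
  rw [absorbs_iff_eventually_cobounded_mapsTo] at h2 ⊢
  filter_upwards [h2] with c hc
  rintro _ ⟨p, hp, rfl⟩
  refine hWV ?_
  have := hc ⟨p, hp, rfl⟩
  simp only [Set.mem_preimage, map_smul]
  exact this

namespace BornologicalTensor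

variable [BoundedConstSMul 𝕜 A M]

variable (𝕜 A M N) in
/-- The quotient map `M ⊗_β N → M ⊗_A^β N`. -/
def mkL : M ⊗[𝕜] N →ₗ[𝕜] BornologicalTensor 𝕜 A M N where
  toFun z := (Submodule.Quotient.mk z : (M ⊗[𝕜] N) ⧸ closedBalancedRelations 𝕜 A M N)
  map_add' _ _ := rfl
  map_smul' _ _ := rfl

theorem isBoundedMap_mkL :
    letI := bornologicalTensorTopology 𝕜 M N
    IsBoundedMap 𝕜 (mkL 𝕜 A M N) := by
  let τ := bornologicalTensorTopology 𝕜 M N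
  intro B hB
  have hc : Continuous (mkL 𝕜 A M N) := continuous_coinduced_rng
  exact hB.image (⟨mkL 𝕜 A M N, hc⟩ : M ⊗[𝕜] N →L[𝕜] BornologicalTensor 𝕜 A M N)

theorem tmul_smul_comm (a : A) (m : M) (n : N) :
    tmul 𝕜 A (a • m) n = tmul 𝕜 A m (a • n) := by
  let τ := bornologicalTensorTopology 𝕜 M N
  refine (Submodule.Quotient.eq _).2 ?_
  exact subset_closure (AddSubgroup.subset_closure ⟨a, m, n, rfl⟩)

theorem induction_on {motive : BornologicalTensor 𝕜 A M N → Prop} (z : BornologicalTensor 𝕜 A M N)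
    (zero : motive 0) (tmul : ∀ m n, motive (tmul 𝕜 A m n))
    (add : ∀ x y, motive x → motive y → motive (x + y)) : motive z := by
  obtain ⟨w, rfl⟩ := Submodule.Quotient.mk_surjective _ z
  induction w using TensorProduct.induction_on with
  | zero => exact zero
  | tmul m n => exact tmul m n
  | add x y hx hy => exact add _ _ hx hy

section Lift

variable {G : Type*} [AddCommGroup G] [Module 𝕜 G] [Module A G] [IsScalarTower 𝕜 A G]
  [TopologicalSpace G] [PolynormableSpace 𝕜 G] [T1Space G]

/-- The induced map on `M ⊗_β N` is continuous and kills the relations. As points of `G` are closed,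
so is its kernel, which therefore contains the closure `J`. The quotient topology then makes the
factored map continuous, hence bounded. -/
theorem exists_lift (β : M →ₗ[A] N →ₗ[𝕜] G) (hbal : ∀ (a : A) m n, β (a • m) n = β m (a • n))
    (hβ : IsBoundedMap 𝕜 fun p : M × N => β p.1 p.2) :
    ∃ Φ : BornologicalTensor 𝕜 A M N →ₗ[A] G,
      (∀ m n, Φ (tmul 𝕜 A m n) = β m n) ∧ IsBoundedMap 𝕜 Φ := by
  let τ := bornologicalTensorTopology 𝕜 M N
  let L : M ⊗[𝕜] N →ₗ[A] G := TensorProduct.AlgebraTensorModule.lift β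
  have hL : Continuous L :=
    continuous_of_isBoundedMap_tmul (L.restrictScalars 𝕜) hβ
  have hker : closedBalancedRelations 𝕜 A M N ≤ LinearMap.ker L := by
    have hcl : IsClosed (L ⁻¹' {0}) := isClosed_singleton.preimage hL
    have hsub : balancedRelations 𝕜 A M N ≤ (LinearMap.ker L).toAddSubgroup := by
      refine (AddSubgroup.closure_le _).2 ?_
      rintro _ ⟨a, m, n, rfl⟩
      change L _ = 0
      rw [map_sub, sub_eq_zero]
      exact hbal a m n
    exact fun z hz => closure_minimal (fun w hw => hsub hw) hcl hz
  let Φ : BornologicalTensor 𝕜 A M N →ₗ[A] G := Submodule.liftQ _ L hker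
  have hΦ : Continuous Φ := continuous_coinduced_dom.2 hL
  refine ⟨Φ, fun m n => rfl, fun B hB => ?_⟩
  exact hB.image (⟨Φ.restrictScalars 𝕜, hΦ⟩ : BornologicalTensor 𝕜 A M N →L[𝕜] G)

/-- A bounded balanced bilinear map `β : M × N → G` exhibits `G` as the bornological tensor product
`M ⊗_A^β N` if elements of `G` decompose as sums of the `β (P k g) (t k)` with bounded linear maps
`P k`, finitely many of which are nonzero on each bounded set. -/
theorem exists_linearEquiv [ContinuousSMul 𝕜 N] (β : M →ₗ[A] N →ₗ[𝕜] G)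
    (hbal : ∀ (a : A) m n, β (a • m) n = β m (a • n))
    (hβ : IsBoundedMap 𝕜 fun p : M × N => β p.1 p.2)
    {κ : Type*} (t : κ → N) (P : κ → G →ₗ[𝕜] M) (hP : ∀ k, IsBoundedMap 𝕜 (P k))
    (hfin : ∀ B : Set G, Bornology.IsVonNBounded 𝕜 B →
      ∃ S : Finset κ, ∀ g ∈ B, ∀ k ∉ S, P k g = 0)
    (hG : ∀ g, ∑ᶠ k, β (P k g) (t k) = g)
    (hMN : ∀ m n, ∑ᶠ k, tmul 𝕜 A (P k (β m n)) (t k) = tmul 𝕜 A m n) :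
    ∃ Φ : BornologicalTensor 𝕜 A M N ≃ₗ[A] G,
      (∀ m n, Φ (tmul 𝕜 A m n) = β m n) ∧ IsBoundedMap 𝕜 Φ ∧ IsBoundedMap 𝕜 Φ.symm := by
  obtain ⟨Φ, hΦ, hΦb⟩ := exists_lift β hbal hβ
  let τ := bornologicalTensorTopology 𝕜 M N
  have hpoly : PolynormableSpace 𝕜 (M ⊗[𝕜] N) := polynormable_finestLocallyConvex _ _ _
  have := (PolynormableSpace.withSeminorms 𝕜 (M ⊗[𝕜] N)).topologicalAddGroup
  have := (PolynormableSpace.withSeminorms 𝕜 (M ⊗[𝕜] N)).continuousSMul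
  have := (PolynormableSpace.withSeminorms 𝕜 G).continuousSMul
  have hsupp : ∀ (S : Finset κ) (g : G), (∀ k ∉ S, P k g = 0) →
      (Function.support fun k => mkL 𝕜 A M N (P k g ⊗ₜ t k)) ⊆ S := by
    intro S g hS k hk
    by_contra hkS
    refine hk ?_
    change mkL 𝕜 A M N (P k g ⊗ₜ t k) = 0
    rw [hS k hkS, TensorProduct.zero_tmul, map_zero]
  have hfin1 : ∀ g, ∃ S : Finset κ, ∀ k ∉ S, P k g = 0 := by
    intro g
    obtain ⟨S, hS⟩ := hfin {g} (Bornology.isVonNBounded_singleton g)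
    exact ⟨S, hS g rfl⟩
  have hfs : ∀ g, (Function.support fun k => mkL 𝕜 A M N (P k g ⊗ₜ t k)).Finite := by
    intro g
    obtain ⟨S, hS⟩ := hfin1 g
    exact S.finite_toSet.subset (hsupp S g hS)
  -- Additivity of `Ψ` is enough: the identity `Ψ ∘ Φ = id` is checked on elementary tensors, and
  -- `A`-linearity of the inverse is inherited from `Φ`.
  let Ψ : G → BornologicalTensor 𝕜 A M N := fun g => ∑ᶠ k, mkL 𝕜 A M N (P k g ⊗ₜ t k)
  have hΨadd : ∀ g g', Ψ (g + g') = Ψ g + Ψ g' := by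
    intro g g'
    rw [← finsum_add_distrib (hfs g) (hfs g')]
    exact finsum_congr fun k => by rw [map_add, TensorProduct.add_tmul, map_add]
  have hΨzero : Ψ 0 = 0 := by simpa using hΨadd 0 0
  have hleft : Function.LeftInverse Ψ Φ := by
    intro z
    induction z using induction_on with
    | zero => rw [map_zero, hΨzero]
    | tmul m n => rw [hΦ]; exact hMN m n
    | add x y hx hy => rw [map_add, hΨadd, hx, hy]
  have hright : Function.RightInverse Ψ Φ := by
    intro g
    change Φ.toAddMonoidHom (∑ᶠ k, mkL 𝕜 A M N (P k g ⊗ₜ t k)) = g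
    rw [AddMonoidHom.map_finsum _ (hfs g)]
    exact (finsum_congr fun k => hΦ _ _).trans (hG g)
  refine ⟨{ Φ with invFun := Ψ, left_inv := hleft, right_inv := hright }, hΦ, hΦb, ?_⟩
  intro B hB
  obtain ⟨S, hS⟩ := hfin B hB
  have hb : ∀ k, IsBoundedMap 𝕜 fun g : G => P k g ⊗ₜ[𝕜] t k := by
    intro k C hC
    refine (isBoundedMap_tmul 𝕜 M N _ (((hP k) C hC).prod
      (Bornology.isVonNBounded_singleton (t k)))).subset ?_
    rintro _ ⟨g, hg, rfl⟩
    exact ⟨(P k g, t k), ⟨⟨g, hg, rfl⟩, rfl⟩, rfl⟩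
  -- On `B` the sum runs over the fixed finite set `S`. It is formed in `M ⊗_β N`, where addition is
  -- known to be continuous, and only then sent to the quotient.
  refine (isBoundedMap_mkL _ (IsBoundedMap.sum hb S B hB)).subset ?_
  rintro _ ⟨g, hg, rfl⟩
  refine ⟨_, ⟨g, hg, rfl⟩, ?_⟩
  change mkL 𝕜 A M N (∑ k ∈ S, P k g ⊗ₜ t k) = Ψ g
  rw [map_sum]
  exact (finsum_eq_sum_of_support_subset _ (hsupp S g (hS g hg))).symm

end Lift

end BornologicalTensor

end BornologicalTensor

/-! ### Bounded sets in the spaces of sections -/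

section Sections

variable {𝕜 H : Type*} {M : Type*} [RCLike 𝕜] [NormedAddCommGroup H] [NormedSpace ℝ H]
  [TopologicalSpace M] [ChartedSpace H M]
  {F : Type*} [NormedAddCommGroup F] [NormedSpace 𝕜 F] [NormedSpace ℝ F] [IsScalarTower ℝ 𝕜 F]
  {E : M → Type*} [TopologicalSpace (TotalSpace F E)]
  [∀ x, AddCommGroup (E x)] [∀ x, Module 𝕜 (E x)] [∀ x, TopologicalSpace (E x)]
  [FiberBundle F E] [VectorBundle 𝕜 F E]
  [IsManifold 𝓘(ℝ, H) ∞ M] [SmoothVectorBundle 𝕜 H F E]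

namespace SmoothSection

variable (𝕜 H F E) in
/-- The order zero seminorm at a point. -/
def pointIndex (x : M) : SeminormIndex H F E where
  chart := chartAt H x
  chart_mem := chart_mem_atlas H x
  triv := trivializationAt F E x
  triv_mem := inferInstance
  K := {x}
  isCompact := isCompact_singleton
  subset := by
    rintro _ rfl
    exact ⟨mem_chart_source H _, mem_baseSet_trivializationAt F E _⟩
  order := 0

theorem SeminormIndex.toSeminorm_le (i : SeminormIndex H F E) (s : SmoothSection 𝕜 H F E) {C : ℝ}
    (hC : 0 ≤ C) (h : ∀ x ∈ i.K, ‖iteratedFDerivWithin ℝ i.order (localRep i.chart i.triv s)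
      (localDomain i.chart i.triv) (i.chart x)‖ ≤ C) : i.toSeminorm s ≤ C :=
  Real.iSup_le (fun x => h x x.2) hC

theorem SeminormIndex.le_toSeminorm (i : SeminormIndex H F E) (s : SmoothSection 𝕜 H F E) {x : M}
    (hx : x ∈ i.K) : ‖iteratedFDerivWithin ℝ i.order (localRep i.chart i.triv s)
      (localDomain i.chart i.triv) (i.chart x)‖ ≤ i.toSeminorm s :=
  le_ciSup (i.bddAbove s) ⟨x, hx⟩

/-- At order zero the seminorm is the norm of the coordinate vector of `s x`, and a trivialization
is a linear isomorphism on the fibre. These seminorms separate points and detect where a section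
lives. -/
theorem toSeminorm_pointIndex_eq_zero_iff (x : M) (s : SmoothSection 𝕜 H F E) :
    (pointIndex H F E x).toSeminorm s = 0 ↔ s x = 0 := by
  have h1 : (pointIndex H F E x).toSeminorm s = ‖(trivializationAt F E x ⟨x, s x⟩).2‖ := by
    have : Unique (pointIndex H F E x).K := inferInstanceAs (Unique ({x} : Set M))
    refine (ciSup_unique).trans ?_
    have h0 : ((default : (pointIndex H F E x).K) : M) = x :=
      mem_singleton_iff.1 (default : (pointIndex H F E x).K).2
    rw [h0]
    refine (norm_iteratedFDerivWithin_zero).trans ?_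
    change ‖(trivializationAt F E x ⟨(chartAt H x).symm (chartAt H x x), s _⟩).2‖ = _
    rw [(chartAt H x).left_inv (mem_chart_source H x)]
  have hx := mem_baseSet_trivializationAt F E x
  rw [h1, norm_eq_zero]
  have h2 : (trivializationAt F E x ⟨x, s x⟩).2 =
      (trivializationAt F E x).continuousLinearEquivAt 𝕜 x hx (s x) := rfl
  rw [h2, map_eq_zero_iff _ (ContinuousLinearEquiv.injective _)]

theorem isVonNBounded_iff {B : Set (SmoothSection 𝕜 H F E)} :
    Bornology.IsVonNBounded 𝕜 B ↔
      ∀ i : SeminormIndex H F E, ∃ C, 0 ≤ C ∧ ∀ s ∈ B, i.toSeminorm s ≤ C := by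
  rw [withSeminorms.isVonNBounded_iff_seminorm_bounded]
  refine forall_congr' fun i => ⟨?_, ?_⟩
  · rintro ⟨C, hC, h⟩
    exact ⟨C, hC.le, fun s hs => (h s hs).le⟩
  · rintro ⟨C, hC, h⟩
    exact ⟨C + 1, by positivity, fun s hs => (h s hs).trans_lt (lt_add_one C)⟩

end SmoothSection

namespace CompactSection

variable (𝕜 H F E) in
/-- The inclusion `Γ_c(E) → Γ(E)`. -/
def incl : CompactSection 𝕜 H F E →ₗ[SmoothFunction 𝕜 H M] SmoothSection 𝕜 H F E :=
  (compactSectionSubmodule 𝕜 H F E).subtype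

instance : PolynormableSpace 𝕜 (CompactSection 𝕜 H F E) := polynormable_finestLocallyConvex _ _ _

theorem ext {s t : CompactSection 𝕜 H F E} (h : ∀ x, s x = t x) : s = t :=
  Subtype.ext (Subtype.ext (funext h))

/-- How continuity is tested on the inductive limit: the topology defined by `p` alone is locally
convex, and the domination on each `Γ_{c,L}` makes the inclusions continuous for it, so the (LF)
topology is finer. -/
theorem continuous_seminorm (p : Seminorm 𝕜 (CompactSection 𝕜 H F E))
    (h : ∀ L : Set M, IsCompact L → ∃ r : Seminorm 𝕜 (SmoothSection 𝕜 H F E), Continuous r ∧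
      ∀ s : CompactSection 𝕜 H F E, SmoothSection.support s ⊆ L → p s ≤ r (incl 𝕜 H F E s)) :
    Continuous p := by
  let P : SeminormFamily 𝕜 (CompactSection 𝕜 H F E) Unit := fun _ => p
  let τ : TopologicalSpace (CompactSection 𝕜 H F E) := P.moduleFilterBasis.topology
  have hτ : WithSeminorms (topology := τ) P := ⟨rfl⟩
  have hle : instTopologicalSpace 𝕜 H F E ≤ τ := by
    refine sInf_le ⟨hτ.toPolynormableSpace, fun L hL => ?_⟩
    obtain ⟨r, hr, hpr⟩ := h L hL
    refine continuous_iff_continuousAt.2 fun s₀ => ?_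
    refine (hτ.tendsto_nhds _ _).2 fun _ ε hε => ?_
    have hc : Filter.Tendsto (fun s : SupportedIn 𝕜 H F E L => r (s.1 - s₀.1)) (𝓝 s₀)
        (𝓝 (r (s₀.1 - s₀.1))) := by
      have := (SmoothSection.withSeminorms (𝕜 := 𝕜) (H := H) (F := F)
        (E := E)).topologicalAddGroup
      exact (hr.comp (continuous_subtype_val.sub continuous_const)).continuousAt
    rw [sub_self, map_zero] at hc
    filter_upwards [hc.eventually_lt_const hε] with s hs
    -- The bound by `r` applies to the difference because the difference again has support in `L`.
    refine (hpr (ofSupportedIn 𝕜 H F E hL s - ofSupportedIn 𝕜 H F E hL s₀) ?_).trans_lt hs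
    refine (closure_mono (t := {x | s.1 x ≠ 0} ∪ {x | s₀.1 x ≠ 0}) fun x hx => ?_).trans
      (closure_union.trans_subset (union_subset s.2 s₀.2))
    by_contra hx'
    rw [mem_union, not_or] at hx'
    have h1 : s.1 x = 0 := not_not.1 hx'.1
    have h2 : s₀.1 x = 0 := not_not.1 hx'.2
    exact hx (show s.1 x - s₀.1 x = 0 by rw [h1, h2, sub_zero])
  exact continuous_le_dom hle (hτ.continuous_seminorm ())

theorem exists_bound_of_continuous {p : Seminorm 𝕜 (CompactSection 𝕜 H F E)} (hp : Continuous p)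
    {B : Set (CompactSection 𝕜 H F E)} (hB : Bornology.IsVonNBounded 𝕜 B) :
    ∃ C, 0 ≤ C ∧ ∀ s ∈ B, p s ≤ C := by
  obtain ⟨C, hC, h⟩ := (PolynormableSpace.withSeminorms 𝕜
    (CompactSection 𝕜 H F E)).isVonNBounded_iff_seminorm_bounded.1 hB ⟨p, hp⟩
  exact ⟨C, hC.le, fun s hs => (h s hs).le⟩

theorem continuous_toSeminorm_incl (i : SmoothSection.SeminormIndex H F E) :
    Continuous ((i.toSeminorm (𝕜 := 𝕜)).comp ((incl 𝕜 H F E).restrictScalars 𝕜)) :=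
  continuous_seminorm _ fun _ _ =>
    ⟨i.toSeminorm, SmoothSection.withSeminorms.continuous_seminorm i, fun _ _ => le_rfl⟩

/-- Required of the target in `BornologicalTensor.exists_lift`, where a closed kernel must absorb
`J`. The point seminorms separate sections. -/
instance : T1Space (CompactSection 𝕜 H F E) := by
  refine (PolynormableSpace.withSeminorms 𝕜 (CompactSection 𝕜 H F E)).T1_of_separating ?_
  intro s hs
  obtain ⟨x, hx⟩ : ∃ x, s x ≠ 0 := by
    by_contra! h
    exact hs (ext h)
  refine ⟨⟨_, continuous_toSeminorm_incl (SmoothSection.pointIndex H F E x)⟩, fun h => hx ?_⟩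
  exact (SmoothSection.toSeminorm_pointIndex_eq_zero_iff x (incl 𝕜 H F E s)).1 h

/-- Every bounded set of compactly supported sections lives on a common compact set. -/
theorem exists_compact_of_isVonNBounded [T2Space M] [SigmaCompactSpace M] [LocallyCompactSpace M]
    {B : Set (CompactSection 𝕜 H F E)} (hB : Bornology.IsVonNBounded 𝕜 B) :
    ∃ L : Set M, IsCompact L ∧ ∀ s ∈ B, SmoothSection.support s ⊆ L := by
  -- If no compact set works, there are `s n ∈ B` and points `x n` outside the `n`-th set of an
  -- exhaustion with `s n (x n) ≠ 0`. A continuous seminorm unbounded on `B` is built from them.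
  by_contra! hL
  let K : CompactExhaustion M := default
  have hex : ∀ n, ∃ s ∈ B, ∃ x ∉ K n, s x ≠ 0 := by
    intro n
    obtain ⟨s, hs, hsup⟩ := hL (K n) (K.isCompact n)
    refine ⟨s, hs, ?_⟩
    by_contra! h
    exact hsup (closure_minimal (fun x hx => by_contra fun hxn => hx (h x hxn))
      (K.isCompact n).isClosed)
  choose s hs x hxK hx using hex
  let e : ℕ → Seminorm 𝕜 (SmoothSection 𝕜 H F E) := fun n =>
    (SmoothSection.pointIndex H F E (x n)).toSeminorm
  have he : ∀ n t, t (x n) = 0 → e n t = 0 := fun n t =>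
    (SmoothSection.toSeminorm_pointIndex_eq_zero_iff (x n) t).2
  have hpos : ∀ n, 0 < e n (incl 𝕜 H F E (s n)) := fun n =>
    lt_of_le_of_ne (apply_nonneg _ _) fun h =>
      hx n ((SmoothSection.toSeminorm_pointIndex_eq_zero_iff (x n) (incl 𝕜 H F E (s n))).1 h.symm)
  -- The weight is chosen so that the `n`-th rescaled point seminorm takes the value `n` on `s n`.
  let c : ℕ → NNReal := fun n => ⟨n / e n (incl 𝕜 H F E (s n)), by have := hpos n; positivity⟩
  let r : ℕ → Seminorm 𝕜 (SmoothSection 𝕜 H F E) := fun n => c n • e n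
  have hr : ∀ n, Continuous (r n) := fun n =>
    (SmoothSection.withSeminorms.continuous_seminorm (SmoothSection.pointIndex H F E
      (x n))).const_smul (c n)
  -- If `L ⊆ K m`, then for `n ≥ m` the point `x n` lies outside `L`, and the `n`-th seminorm
  -- vanishes on sections supported in `L`. The supremum of all of them is thus finite, and on
  -- `Γ_{c,L}` it is dominated by a finite sum.
  have hle : ∀ L : Set M, IsCompact L → ∃ m, ∀ t : CompactSection 𝕜 H F E,
      SmoothSection.support t ⊆ L → ∀ n, r n (incl 𝕜 H F E t) ≤
        (∑ k ∈ Finset.range m, r k) (incl 𝕜 H F E t) := by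
    intro L hL
    obtain ⟨m, hm⟩ := K.exists_superset_of_isCompact hL
    refine ⟨m, fun t ht n => ?_⟩
    rw [sum_apply]
    by_cases hn : n < m
    · exact Finset.single_le_sum (f := fun k => r k (incl 𝕜 H F E t))
        (fun _ _ => apply_nonneg _ _) (Finset.mem_range.2 hn)
    · have h0 : incl 𝕜 H F E t (x n) = 0 := by
        by_contra h
        exact hxK n (K.subset (not_lt.1 hn) (hm (ht (subset_closure h))))
      have h1 : r n (incl 𝕜 H F E t) = 0 := by
        change c n • e n _ = 0
        rw [he n _ h0, smul_zero]
      rw [h1]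
      exact Finset.sum_nonneg fun _ _ => apply_nonneg _ _
  let q : ℕ → Seminorm 𝕜 (CompactSection 𝕜 H F E) := fun n =>
    (r n).comp ((incl 𝕜 H F E).restrictScalars 𝕜)
  have hq : BddAbove (range q) := by
    refine Seminorm.bddAbove_range_iff.2 fun t => ?_
    obtain ⟨m, hm⟩ := hle _ t.2
    exact ⟨_, by rintro _ ⟨n, rfl⟩; exact hm t subset_rfl n⟩
  have hqc : Continuous (⇑(⨆ n, q n : Seminorm 𝕜 (CompactSection 𝕜 H F E))) := by
    refine continuous_seminorm _ fun L hL => ?_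
    obtain ⟨m, hm⟩ := hle L hL
    refine ⟨∑ k ∈ Finset.range m, r k, ?_, fun t ht => ?_⟩
    · have : (⇑(∑ k ∈ Finset.range m, r k) : SmoothSection 𝕜 H F E → ℝ) =
          fun t => ∑ k ∈ Finset.range m, r k t := funext fun t => sum_apply _ _ _
      rw [this]
      exact continuous_finsetSum _ fun k _ => hr k
    · rw [Seminorm.iSup_apply hq]
      exact ciSup_le fun n => hm t ht n
  obtain ⟨C, -, hC⟩ := exists_bound_of_continuous hqc hB
  obtain ⟨n, hn⟩ := exists_nat_gt C
  have h1 : q n (s n) ≤ C := by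
    refine le_trans ?_ (hC (s n) (hs n))
    exact (le_ciSup hq n) (s n)
  have h2 : q n (s n) = n := div_mul_cancel₀ _ (hpos n).ne'
  linarith

/-- Bounded sets of the (LF) space are those of a single step `Γ_{c,L}`. Conversely, such a set is
absorbed by every neighbourhood of zero because the inclusion of `Γ_{c,L}` is continuous. This is
argued with neighbourhoods, as `SupportedIn` is a plain subtype with no vector space structure. -/
theorem isVonNBounded_iff [T2Space M] [SigmaCompactSpace M] [LocallyCompactSpace M]
    {B : Set (CompactSection 𝕜 H F E)} :
    Bornology.IsVonNBounded 𝕜 B ↔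
      (∃ L : Set M, IsCompact L ∧ ∀ s ∈ B, SmoothSection.support s ⊆ L) ∧
      ∀ i : SmoothSection.SeminormIndex H F E, ∃ C, 0 ≤ C ∧
        ∀ s ∈ B, i.toSeminorm (incl 𝕜 H F E s) ≤ C := by
  refine ⟨fun hB => ⟨exists_compact_of_isVonNBounded hB, fun i =>
    exists_bound_of_continuous (continuous_toSeminorm_incl i) hB⟩, ?_⟩
  rintro ⟨⟨L, hL, hBL⟩, hb⟩ V hV
  have hB' : Bornology.IsVonNBounded 𝕜 (incl 𝕜 H F E '' B) := by
    refine SmoothSection.isVonNBounded_iff.2 fun i => ?_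
    obtain ⟨C, hC, h⟩ := hb i
    exact ⟨C, hC, by rintro _ ⟨s, hs, rfl⟩; exact h s hs⟩
  have hincl : Continuous (ofSupportedIn 𝕜 H F E hL) :=
    continuous_sInf_rng.2 fun t ht => ht.2 L hL
  have hsmul : ∀ (c : 𝕜) (s : SmoothSection 𝕜 H F E), SmoothSection.support s ⊆ L →
      SmoothSection.support (c • s : SmoothSection 𝕜 H F E) ⊆ L := fun c s h =>
    (closure_mono fun x (hx : c • s x ≠ 0) (h : s x = 0) => hx (by rw [h, smul_zero])).trans h
  have h0 : SmoothSection.support (0 : SmoothSection 𝕜 H F E) ⊆ L := by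
    refine closure_minimal (fun x hx => (hx rfl).elim) hL.isClosed
  have hV' : ofSupportedIn 𝕜 H F E hL ⁻¹' V ∈ 𝓝 (⟨0, h0⟩ : SupportedIn 𝕜 H F E L) :=
    hincl.continuousAt.preimage_mem_nhds hV
  -- Yields a zero neighbourhood `W` of `Γ(E)` whose sections supported in `L` lie in `V`. It
  -- absorbs the image of `B`.
  rw [nhds_subtype_eq_comap] at hV'
  obtain ⟨W, hW, hWV⟩ := hV'
  have h := hB' hW
  rw [absorbs_iff_eventually_cobounded_mapsTo] at h ⊢
  filter_upwards [h] with c hc s hs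
  exact @hWV ⟨c⁻¹ • s.1, hsmul _ _ (hBL s hs)⟩ (hc ⟨s, hs, rfl⟩)

end CompactSection

end Sections

/-! ### Derivative estimates and smoothness in local trivializations -/

/-- Within an open set the derivatives depend only on the germ. This permits passing between the
local domains of `e₁`, `e₂` and `e₁ ⊗ e₂`, over which the various seminorms differentiate. -/
theorem iteratedFDerivWithin_eq_of_eventuallyEq_of_isOpen {D G : Type*} [NormedAddCommGroup D]
    [NormedSpace ℝ D] [NormedAddCommGroup G] [NormedSpace ℝ G] {f g : D → G} {U V : Set D} {y : D}
    (hU : IsOpen U) (hV : IsOpen V) (hyU : y ∈ U) (hyV : y ∈ V) (h : f =ᶠ[𝓝 y] g) (n : ℕ) :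
    iteratedFDerivWithin ℝ n f U y = iteratedFDerivWithin ℝ n g V y := by
  rw [iteratedFDerivWithin_of_isOpen n hU hyU, iteratedFDerivWithin_of_isOpen n hV hyV]
  exact (h.iteratedFDeriv ℝ n).eq_of_nhds

/-- Uniform bounds for the derivatives of `f` and `g` at a point give one for `T f g`. -/
theorem exists_iteratedFDerivWithin_bilinear_bound {D V₁ V₂ W : Type*} [NormedAddCommGroup D]
    [NormedSpace ℝ D] [NormedAddCommGroup V₁] [NormedSpace ℝ V₁] [NormedAddCommGroup V₂]
    [NormedSpace ℝ V₂] [NormedAddCommGroup W] [NormedSpace ℝ W] (T : V₁ →L[ℝ] V₂ →L[ℝ] W) (n : ℕ)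
    {C₁ C₂ : ℕ → ℝ} (hC₁ : ∀ j, 0 ≤ C₁ j) (hC₂ : ∀ j, 0 ≤ C₂ j) :
    ∃ C : ℝ, 0 ≤ C ∧ ∀ {U U₁ U₂ : Set D} {f : D → V₁} {g : D → V₂} {h : D → W} {y : D},
      IsOpen U → IsOpen U₁ → IsOpen U₂ → U ⊆ U₁ → U ⊆ U₂ → y ∈ U →
      ContDiffOn ℝ ∞ f U₁ → ContDiffOn ℝ ∞ g U₂ → EqOn h (fun z => T (f z) (g z)) U →
      (∀ j, ‖iteratedFDerivWithin ℝ j f U₁ y‖ ≤ C₁ j) →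
      (∀ j, ‖iteratedFDerivWithin ℝ j g U₂ y‖ ≤ C₂ j) →
      ‖iteratedFDerivWithin ℝ n h U y‖ ≤ C := by
  -- The Leibniz bound. It involves only `T`, `n` and the two sequences, so it is uniform in the
  -- functions and in the point.
  refine ⟨‖T‖ * ∑ j ∈ Finset.range (n + 1), (n.choose j : ℝ) * C₁ j * C₂ (n - j),
    mul_nonneg T.opNorm_nonneg (Finset.sum_nonneg fun j _ =>
      mul_nonneg (mul_nonneg (Nat.cast_nonneg _) (hC₁ _)) (hC₂ _)), ?_⟩
  intro U U₁ U₂ f g h y hU hU₁ hU₂ h₁ h₂ hy hf hg hh hb₁ hb₂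
  rw [iteratedFDerivWithin_congr hh hy]
  refine (T.norm_iteratedFDerivWithin_le_of_bilinear (hf.mono h₁) (hg.mono h₂) hU.uniqueDiffOn hy
    (by exact_mod_cast le_top)).trans ?_
  gcongr with j hj
  · exact mul_nonneg (Nat.cast_nonneg _) (hC₁ j)
  · rw [iteratedFDerivWithin_eq_of_eventuallyEq_of_isOpen hU hU₁ hy (h₁ hy) .rfl]
    exact hb₁ j
  · rw [iteratedFDerivWithin_eq_of_eventuallyEq_of_isOpen hU hU₂ hy (h₂ hy) .rfl]
    exact hb₂ (n - j)

section Sections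

variable {𝕜 H : Type*} {M : Type*} [RCLike 𝕜] [NormedAddCommGroup H] [NormedSpace ℝ H]
  [TopologicalSpace M] [ChartedSpace H M]
  {F : Type*} [NormedAddCommGroup F] [NormedSpace 𝕜 F] [NormedSpace ℝ F] [IsScalarTower ℝ 𝕜 F]
  {E : M → Type*} [TopologicalSpace (TotalSpace F E)]
  [∀ x, AddCommGroup (E x)] [∀ x, Module 𝕜 (E x)] [∀ x, TopologicalSpace (E x)]
  [FiberBundle F E] [VectorBundle 𝕜 F E]

namespace SmoothSection

variable (𝕜) in
-- The new coordinate is the operator-valued transition function, smooth over `ℝ` after restriction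
-- of scalars, applied to the old coordinate.
theorem contMDiffAt_coord_change [SmoothVectorBundle 𝕜 H F E] {e e' : Trivialization F (π F E)}
    [MemTrivializationAtlas e] [MemTrivializationAtlas e'] {s : ∀ x, E x} {x : M}
    (hx : x ∈ e.baseSet) (hx' : x ∈ e'.baseSet)
    (h : ContMDiffAt 𝓘(ℝ, H) 𝓘(ℝ, F) ∞ (fun y => (e ⟨y, s y⟩).2) x) :
    ContMDiffAt 𝓘(ℝ, H) 𝓘(ℝ, F) ∞ (fun y => (e' ⟨y, s y⟩).2) x := by
  have hmem := (e.open_baseSet.inter e'.open_baseSet).mem_nhds ⟨hx, hx'⟩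
  have hc := (SmoothVectorBundle.contMDiffOn_coordChangeL (𝕜 := 𝕜) (H := H) e e').contMDiffAt hmem
  have hR : ContMDiffAt 𝓘(ℝ, H) 𝓘(ℝ, F →L[ℝ] F) ∞ (fun b : M =>
      (e.coordChangeL 𝕜 e' b : F →L[𝕜] F).restrictScalars ℝ) x :=
    ((ContinuousLinearMap.restrictScalarsL 𝕜 F F ℝ ℝ).contDiff.contMDiff.contMDiffAt).comp x hc
  refine (hR.clm_apply h).congr_of_eventuallyEq ?_
  filter_upwards [hmem] with y hy
  rw [ContinuousLinearMap.coe_restrictScalars', ContinuousLinearEquiv.coe_coe,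
    Trivialization.coordChangeL_apply _ _ hy]
  rw [e.symm_proj_apply ⟨y, s y⟩ hy.1]

theorem contMDiffAt_coord [SmoothVectorBundle 𝕜 H F E] (s : SmoothSection 𝕜 H F E)
    (e : Trivialization F (π F E)) [MemTrivializationAtlas e] {x : M} (hx : x ∈ e.baseSet) :
    ContMDiffAt 𝓘(ℝ, H) 𝓘(ℝ, F) ∞ (fun y => (e ⟨y, s y⟩).2) x :=
  contMDiffAt_coord_change 𝕜 (mem_baseSet_trivializationAt F E x) hx
    ((contMDiffAt_section x).1 (s.2 x))

variable (𝕜 H F E) in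
/-- A section is smooth if near every point it is smooth in some local trivialization. -/
theorem contMDiff_of_coord [SmoothVectorBundle 𝕜 H F E] {s : ∀ x, E x}
    (h : ∀ x, ∃ (e : Trivialization F (π F E)) (_ : MemTrivializationAtlas e), x ∈ e.baseSet ∧
      ContMDiffAt 𝓘(ℝ, H) 𝓘(ℝ, F) ∞ (fun y => (e ⟨y, s y⟩).2) x) :
    s ∈ smoothSectionSubmodule 𝕜 H F E := by
  intro x
  obtain ⟨e, he, hx, hs⟩ := h x
  exact (contMDiffAt_section x).2
    (contMDiffAt_coord_change 𝕜 hx (mem_baseSet_trivializationAt F E x) hs)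

theorem support_subset_of_forall {E' : M → Type*} [∀ x, AddCommGroup (E' x)]
    {s : ∀ x, E x} {s' : ∀ x, E' x} (h : ∀ x, s x = 0 → s' x = 0) :
    closure {x | s' x ≠ 0} ⊆ support s :=
  closure_mono fun x hx h' => hx (h x h')

end SmoothSection

end Sections

/-! ### Tensor products of sections -/

namespace TensorBundle

variable (𝕜 : Type*) [RCLike 𝕜]
variable {H M : Type*} [NormedAddCommGroup H] [NormedSpace ℝ H]
  [TopologicalSpace M] [ChartedSpace H M]
  {F₁ : Type*} [NormedAddCommGroup F₁] [NormedSpace 𝕜 F₁] [NormedSpace ℝ F₁] [IsScalarTower ℝ 𝕜 F₁]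
  [FiniteDimensional 𝕜 F₁]
  {E₁ : M → Type*} [TopologicalSpace (TotalSpace F₁ E₁)]
  [∀ x, AddCommGroup (E₁ x)] [∀ x, Module 𝕜 (E₁ x)] [∀ x, TopologicalSpace (E₁ x)]
  [FiberBundle F₁ E₁] [VectorBundle 𝕜 F₁ E₁]
  {F₂ : Type*} [NormedAddCommGroup F₂] [NormedSpace 𝕜 F₂] [NormedSpace ℝ F₂] [IsScalarTower ℝ 𝕜 F₂]
  [FiniteDimensional 𝕜 F₂]
  {E₂ : M → Type*} [TopologicalSpace (TotalSpace F₂ E₂)]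
  [∀ x, AddCommGroup (E₂ x)] [∀ x, Module 𝕜 (E₂ x)] [∀ x, TopologicalSpace (E₂ x)]
  [FiberBundle F₂ E₂] [VectorBundle 𝕜 F₂ E₂]

section Trivialization

variable (e₁ : Trivialization F₁ (π F₁ E₁)) (e₂ : Trivialization F₂ (π F₂ E₂))
  [MemTrivializationAtlas e₁] [MemTrivializationAtlas e₂]

/-- The local trivialization `e₁ ⊗ e₂` of `E₁ ⊗ E₂`. -/
def trivialization :
    Trivialization (TensorFibre 𝕜 F₁ F₂) (π (TensorFibre 𝕜 F₁ F₂) (TensorBundle 𝕜 E₁ E₂)) :=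
  (vectorPrebundle 𝕜 F₁ E₁ F₂ E₂).trivializationOfMemPretrivializationAtlas
    ⟨e₁, e₂, inferInstance, inferInstance, rfl⟩

instance : MemTrivializationAtlas (trivialization 𝕜 e₁ e₂) :=
  ⟨⟨_, ⟨e₁, e₂, inferInstance, inferInstance, rfl⟩, rfl⟩⟩

/-- By construction of the atlas. Hence every defining seminorm of `Γ(E₁ ⊗ E₂)` can be computed from
a pair of trivializations of the factors. -/
theorem exists_eq_trivialization
    (e : Trivialization (TensorFibre 𝕜 F₁ F₂) (π (TensorFibre 𝕜 F₁ F₂) (TensorBundle 𝕜 E₁ E₂)))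
    [he : MemTrivializationAtlas e] :
    ∃ (e₁ : Trivialization F₁ (π F₁ E₁)) (e₂ : Trivialization F₂ (π F₂ E₂))
      (_ : MemTrivializationAtlas e₁) (_ : MemTrivializationAtlas e₂),
      e = trivialization 𝕜 e₁ e₂ := by
  obtain ⟨_, ⟨e₁, e₂, he₁, he₂, rfl⟩, rfl⟩ := he
  exact ⟨e₁, e₂, he₁, he₂, rfl⟩

theorem trivialization_apply (x : M) (z : TensorBundle 𝕜 E₁ E₂ x) :
    (trivialization 𝕜 e₁ e₂ ⟨x, z⟩).2 = fibreMap 𝕜 e₁ e₂ x z := rfl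

end Trivialization

section Tmul

variable (F₁ F₂) in
/-- The bilinear map `(v, w) ↦ v ⊗ w` on the typical fibres. -/
def tmulL : F₁ →L[𝕜] F₂ →L[𝕜] TensorFibre 𝕜 F₁ F₂ :=
  LinearMap.toContinuousLinearMap
    ((LinearMap.toContinuousLinearMap (𝕜 := 𝕜) (E := F₂)
      (F' := TensorFibre 𝕜 F₁ F₂)).toLinearMap ∘ₗ
      (TensorProduct.mk 𝕜 F₁ F₂ : F₁ →ₗ[𝕜] F₂ →ₗ[𝕜] TensorFibre 𝕜 F₁ F₂))

theorem trivialization_tmul (e₁ : Trivialization F₁ (π F₁ E₁)) (e₂ : Trivialization F₂ (π F₂ E₂))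
    [MemTrivializationAtlas e₁] [MemTrivializationAtlas e₂] {x : M}
    (hx : x ∈ e₁.baseSet ∩ e₂.baseSet) (v : E₁ x) (w : E₂ x) :
    (trivialization 𝕜 e₁ e₂ ⟨x, tmul 𝕜 v w⟩).2 =
      (tmulL 𝕜 F₁ F₂).bilinearRestrictScalars ℝ (e₁ ⟨x, v⟩).2 (e₂ ⟨x, w⟩).2 := by
  rw [trivialization_apply]
  change e₁.linearMapAt 𝕜 x v ⊗ₜ[𝕜] e₂.linearMapAt 𝕜 x w = (e₁ ⟨x, v⟩).2 ⊗ₜ[𝕜] (e₂ ⟨x, w⟩).2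
  rw [Trivialization.linearMapAt_apply, if_pos hx.1, Trivialization.linearMapAt_apply,
    if_pos hx.2]

variable [SmoothVectorBundle 𝕜 H F₁ E₁] [SmoothVectorBundle 𝕜 H F₂ E₂]

variable {𝕜} in
/-- The section `x ↦ s(x) ⊗ t(x)` of `E₁ ⊗ E₂`. -/
def tmulSection (s : SmoothSection 𝕜 H F₁ E₁) (t : SmoothSection 𝕜 H F₂ E₂) :
    SmoothSection 𝕜 H (TensorFibre 𝕜 F₁ F₂) (TensorBundle 𝕜 E₁ E₂) :=
  ⟨fun x => tmul 𝕜 (s x) (t x), by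
    refine SmoothSection.contMDiff_of_coord 𝕜 H _ _ fun x => ?_
    let e₁ := trivializationAt F₁ E₁ x
    let e₂ := trivializationAt F₂ E₂ x
    have hx : x ∈ e₁.baseSet ∩ e₂.baseSet :=
      ⟨mem_baseSet_trivializationAt F₁ E₁ x, mem_baseSet_trivializationAt F₂ E₂ x⟩
    refine ⟨trivialization 𝕜 e₁ e₂, inferInstance, hx, ?_⟩
    refine ContMDiffAt.congr_of_eventuallyEq (f := fun y =>
      (tmulL 𝕜 F₁ F₂).bilinearRestrictScalars ℝ (e₁ ⟨y, s y⟩).2 (e₂ ⟨y, t y⟩).2) ?_ ?_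
    · exact ((ContinuousLinearMap.contDiff _).contMDiff.contMDiffAt.comp x
        (s.contMDiffAt_coord e₁ hx.1)).clm_apply (t.contMDiffAt_coord e₂ hx.2)
    · filter_upwards [(e₁.open_baseSet.inter e₂.open_baseSet).mem_nhds hx] with y hy
      exact trivialization_tmul 𝕜 e₁ e₂ hy _ _⟩

variable [IsManifold 𝓘(ℝ, H) ∞ M]

variable {𝕜} in
-- In a trivialization `e₁ ⊗ e₂` the section `s ⊗ t` is a constant bilinear map applied to the
-- coordinates of `s` and `t`. The Leibniz estimate over the same chart and compact set then bounds
-- it.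
theorem exists_bound_tmulSection {B₁ : Set (SmoothSection 𝕜 H F₁ E₁)}
    {B₂ : Set (SmoothSection 𝕜 H F₂ E₂)}
    (h₁ : ∀ i : SmoothSection.SeminormIndex H F₁ E₁, ∃ C, 0 ≤ C ∧ ∀ s ∈ B₁, i.toSeminorm s ≤ C)
    (h₂ : ∀ i : SmoothSection.SeminormIndex H F₂ E₂, ∃ C, 0 ≤ C ∧ ∀ s ∈ B₂, i.toSeminorm s ≤ C)
    (i : SmoothSection.SeminormIndex H (TensorFibre 𝕜 F₁ F₂) (TensorBundle 𝕜 E₁ E₂)) :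
    ∃ C, 0 ≤ C ∧ ∀ s ∈ B₁, ∀ t ∈ B₂, i.toSeminorm (tmulSection s t) ≤ C := by
  obtain ⟨φ, hφ, e, he, K, hK, hsub, n⟩ := i
  obtain ⟨e₁, e₂, he₁, he₂, rfl⟩ := exists_eq_trivialization 𝕜 e
  let i₁ : ℕ → SmoothSection.SeminormIndex H F₁ E₁ := fun j =>
    ⟨φ, hφ, e₁, he₁, K, hK, fun x hx => ⟨(hsub hx).1, (hsub hx).2.1⟩, j⟩
  let i₂ : ℕ → SmoothSection.SeminormIndex H F₂ E₂ := fun j =>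
    ⟨φ, hφ, e₂, he₂, K, hK, fun x hx => ⟨(hsub hx).1, (hsub hx).2.2⟩, j⟩
  choose C₁ hC₁ hb₁ using fun j => h₁ (i₁ j)
  choose C₂ hC₂ hb₂ using fun j => h₂ (i₂ j)
  obtain ⟨C, hC, h⟩ := exists_iteratedFDerivWithin_bilinear_bound (D := H)
    ((tmulL 𝕜 F₁ F₂).bilinearRestrictScalars ℝ) n hC₁ hC₂
  refine ⟨C, hC, fun s hs t ht => SmoothSection.SeminormIndex.toSeminorm_le _ _ hC ?_⟩
  intro x hx
  exact h (SmoothSection.isOpen_localDomain φ (trivialization 𝕜 e₁ e₂))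
    (SmoothSection.isOpen_localDomain φ e₁) (SmoothSection.isOpen_localDomain φ e₂)
    (fun y hy => ⟨hy.1, hy.2.1⟩) (fun y hy => ⟨hy.1, hy.2.2⟩)
    (SmoothSection.SeminormIndex.map_mem
      ⟨φ, hφ, trivialization 𝕜 e₁ e₂, he, K, hK, hsub, n⟩ ⟨x, hx⟩)
    (SmoothSection.contDiffOn_localRep hφ e₁ s) (SmoothSection.contDiffOn_localRep hφ e₂ t)
    (fun y hy => trivialization_tmul 𝕜 e₁ e₂ hy.2 _ _)
    (fun j => ((i₁ j).le_toSeminorm s hx).trans (hb₁ j s hs))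
    (fun j => ((i₂ j).le_toSeminorm t hx).trans (hb₂ j t ht))

end Tmul

end TensorBundle

namespace TensorBundle

variable (𝕜 : Type*) [RCLike 𝕜]
variable {H M : Type*} [NormedAddCommGroup H] [NormedSpace ℝ H]
  [TopologicalSpace M] [ChartedSpace H M]
  {F₁ : Type*} [NormedAddCommGroup F₁] [NormedSpace 𝕜 F₁] [NormedSpace ℝ F₁] [IsScalarTower ℝ 𝕜 F₁]
  [FiniteDimensional 𝕜 F₁]
  {E₁ : M → Type*} [TopologicalSpace (TotalSpace F₁ E₁)]
  [∀ x, AddCommGroup (E₁ x)] [∀ x, Module 𝕜 (E₁ x)] [∀ x, TopologicalSpace (E₁ x)]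
  [FiberBundle F₁ E₁] [VectorBundle 𝕜 F₁ E₁]
  {F₂ : Type*} [NormedAddCommGroup F₂] [NormedSpace 𝕜 F₂] [NormedSpace ℝ F₂] [IsScalarTower ℝ 𝕜 F₂]
  [FiniteDimensional 𝕜 F₂]
  {E₂ : M → Type*} [TopologicalSpace (TotalSpace F₂ E₂)]
  [∀ x, AddCommGroup (E₂ x)] [∀ x, Module 𝕜 (E₂ x)] [∀ x, TopologicalSpace (E₂ x)]
  [FiberBundle F₂ E₂] [VectorBundle 𝕜 F₂ E₂]

section Compact

variable [SmoothVectorBundle 𝕜 H F₁ E₁] [SmoothVectorBundle 𝕜 H F₂ E₂] [IsManifold 𝓘(ℝ, H) ∞ M]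

variable (H F₁ E₁ F₂ E₂) in
/-- The bilinear map `(s, t) ↦ s ⊗ t` on `Γ_c(E₁) × Γ(E₂)`. -/
def tmulCompact : CompactSection 𝕜 H F₁ E₁ →ₗ[SmoothFunction 𝕜 H M] SmoothSection 𝕜 H F₂ E₂ →ₗ[𝕜]
    CompactSection 𝕜 H (TensorFibre 𝕜 F₁ F₂) (TensorBundle 𝕜 E₁ E₂) :=
  LinearMap.mk₂' (SmoothFunction 𝕜 H M) 𝕜
    (fun s t => ⟨tmulSection (CompactSection.incl 𝕜 H F₁ E₁ s) t,
      s.2.of_isClosed_subset isClosed_closure (SmoothSection.support_subset_of_forall fun x h =>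
        (congrArg (fun v => tmul 𝕜 v (t x)) h).trans (TensorProduct.zero_tmul _ _))⟩)
    (fun s s' t => CompactSection.ext fun x => TensorProduct.add_tmul (s x) (s' x) (t x))
    (fun f s t => CompactSection.ext fun x => (TensorProduct.smul_tmul' (f.1 x) (s x) (t x)).symm)
    (fun s t t' => CompactSection.ext fun x => TensorProduct.tmul_add (s x) (t x) (t' x))
    (fun c s t => CompactSection.ext fun x => TensorProduct.tmul_smul c (s x) (t x))

theorem tmulCompact_smul (f : SmoothFunction 𝕜 H M) (s : CompactSection 𝕜 H F₁ E₁)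
    (t : SmoothSection 𝕜 H F₂ E₂) :
    tmulCompact 𝕜 H F₁ E₁ F₂ E₂ (f • s) t = tmulCompact 𝕜 H F₁ E₁ F₂ E₂ s (f • t) :=
  CompactSection.ext fun x => TensorProduct.smul_tmul (f.1 x) (s x) (t x)

/-- Only the two projections of the bounded set matter. The support of `s ⊗ t` lies in that of `s`,
so the compact set of the first projection serves for the products. -/
theorem isBoundedMap_tmulCompact [T2Space M] [SigmaCompactSpace M] [LocallyCompactSpace M] :
    IsBoundedMap 𝕜 fun p : CompactSection 𝕜 H F₁ E₁ × SmoothSection 𝕜 H F₂ E₂ =>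
      tmulCompact 𝕜 H F₁ E₁ F₂ E₂ p.1 p.2 := by
  intro B hB
  have h₁ := hB.image (ContinuousLinearMap.fst 𝕜 (CompactSection 𝕜 H F₁ E₁)
    (SmoothSection 𝕜 H F₂ E₂))
  have h₂ := hB.image (ContinuousLinearMap.snd 𝕜 (CompactSection 𝕜 H F₁ E₁)
    (SmoothSection 𝕜 H F₂ E₂))
  obtain ⟨⟨L, hL, hsup⟩, hb₁⟩ := CompactSection.isVonNBounded_iff.1 h₁
  have hb₂ := SmoothSection.isVonNBounded_iff.1 h₂
  refine CompactSection.isVonNBounded_iff.2 ⟨⟨L, hL, ?_⟩, fun i => ?_⟩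
  · rintro _ ⟨p, hp, rfl⟩
    refine subset_trans (SmoothSection.support_subset_of_forall fun x h => ?_)
      (hsup _ ⟨p, hp, rfl⟩)
    exact (congrArg (fun v => tmul 𝕜 v (p.2 x)) h).trans (TensorProduct.zero_tmul _ _)
  · obtain ⟨C, hC, h⟩ := exists_bound_tmulSection
      (B₁ := CompactSection.incl 𝕜 H F₁ E₁ '' (ContinuousLinearMap.fst 𝕜 _ _ '' B))
      (fun i => by
        obtain ⟨C, hC, h⟩ := hb₁ i
        exact ⟨C, hC, by rintro _ ⟨s, hs, rfl⟩; exact h s hs⟩) hb₂ i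
    refine ⟨C, hC, ?_⟩
    rintro _ ⟨p, hp, rfl⟩
    exact h _ ⟨_, ⟨p, hp, rfl⟩, rfl⟩ _ ⟨p, hp, rfl⟩

end Compact

/-! ### Contraction with a local frame of the second factor -/

section Contraction

variable (F₁) in
/-- The contraction `id ⊗ ε` of the typical fibre `F₁ ⊗ F₂` with a linear form on `F₂`. -/
def contractFibre (ε : F₂ →ₗ[𝕜] 𝕜) : TensorFibre 𝕜 F₁ F₂ →ₗ[𝕜] F₁ :=
  (TensorProduct.rid 𝕜 F₁).toLinearMap ∘ₗ (ε.lTensor F₁ : F₁ ⊗[𝕜] F₂ →ₗ[𝕜] F₁ ⊗[𝕜] 𝕜)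

variable (F₁) in
/-- The bilinear map `(a, z) ↦ a • (id ⊗ ε) z`. -/
def contractL (ε : F₂ →ₗ[𝕜] 𝕜) : 𝕜 →L[𝕜] TensorFibre 𝕜 F₁ F₂ →L[𝕜] F₁ :=
  LinearMap.toContinuousLinearMap
    (LinearMap.toSpanSingleton 𝕜 (TensorFibre 𝕜 F₁ F₂ →L[𝕜] F₁)
      (LinearMap.toContinuousLinearMap (contractFibre 𝕜 F₁ ε)))

variable (E₁) in
/-- The fibrewise contraction `E₁ x ⊗ E₂ x → E₁ x` with the linear form `ε ∘ (e₂)_x`. -/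
def contract (e₂ : Trivialization F₂ (π F₂ E₂)) [MemTrivializationAtlas e₂] (ε : F₂ →ₗ[𝕜] 𝕜)
    (x : M) : TensorBundle 𝕜 E₁ E₂ x →ₗ[𝕜] E₁ x :=
  (TensorProduct.rid 𝕜 (E₁ x)).toLinearMap ∘ₗ
    ((ε ∘ₗ e₂.linearMapAt 𝕜 x).lTensor (E₁ x) : E₁ x ⊗[𝕜] E₂ x →ₗ[𝕜] E₁ x ⊗[𝕜] 𝕜)

variable (e₁ : Trivialization F₁ (π F₁ E₁)) (e₂ : Trivialization F₂ (π F₂ E₂))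
  [MemTrivializationAtlas e₁] [MemTrivializationAtlas e₂] (ε : F₂ →ₗ[𝕜] 𝕜)

theorem contract_tmul {x : M} (v : E₁ x) (w : E₂ x) :
    contract 𝕜 E₁ e₂ ε x (tmul 𝕜 v w) = ε (e₂.linearMapAt 𝕜 x w) • v :=
  TensorProduct.rid_tmul _ _

/-- Both sides are linear in `z` and agree on elementary tensors. No base set condition arises,
since `linearMapAt` is a linear map at every point. -/
theorem linearMapAt_contract {x : M} (z : TensorBundle 𝕜 E₁ E₂ x) :
    e₁.linearMapAt 𝕜 x (contract 𝕜 E₁ e₂ ε x z) = contractFibre 𝕜 F₁ ε (fibreMap 𝕜 e₁ e₂ x z) := by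
  have h : (e₁.linearMapAt 𝕜 x) ∘ₗ (contract 𝕜 E₁ e₂ ε x) =
      (contractFibre 𝕜 F₁ ε) ∘ₗ (fibreMap 𝕜 e₁ e₂ x) := by
    refine TensorProduct.ext' fun v w => ?_
    change e₁.linearMapAt 𝕜 x (contract 𝕜 E₁ e₂ ε x (tmul 𝕜 v w)) =
      TensorProduct.rid 𝕜 F₁ (e₁.linearMapAt 𝕜 x v ⊗ₜ[𝕜] ε (e₂.linearMapAt 𝕜 x w))
    rw [contract_tmul, map_smul, TensorProduct.rid_tmul]
  exact LinearMap.congr_fun h z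

/-- In coordinates the contraction is the constant bilinear map `contractL`, which gives both
smoothness and the derivative bounds. -/
theorem coord_smul_contract {x : M} (hx : x ∈ e₁.baseSet) (a : 𝕜) (z : TensorBundle 𝕜 E₁ E₂ x) :
    (e₁ ⟨x, a • contract 𝕜 E₁ e₂ ε x z⟩).2 =
      (contractL 𝕜 F₁ ε).bilinearRestrictScalars ℝ a (trivialization 𝕜 e₁ e₂ ⟨x, z⟩).2 := by
  have h : (e₁ ⟨x, a • contract 𝕜 E₁ e₂ ε x z⟩).2 =
      e₁.linearMapAt 𝕜 x (a • contract 𝕜 E₁ e₂ ε x z) := by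
    rw [Trivialization.linearMapAt_apply, if_pos hx]
  rw [h, map_smul, linearMapAt_contract]
  rfl

theorem coord_zero [e₁.IsLinear 𝕜] {x : M} (hx : x ∈ e₁.baseSet) : (e₁ ⟨x, (0 : E₁ x)⟩).2 = 0 := by
  have h := map_zero (e₁.linearMapAt 𝕜 x)
  rwa [Trivialization.linearMapAt_apply, if_pos hx] at h

variable [SmoothVectorBundle 𝕜 H F₁ E₁] [SmoothVectorBundle 𝕜 H F₂ E₂]

variable (H) in
-- The contraction is meaningful only over the base set of `e₂`, but the factor `ρ` has its closed
-- support there, so extension by zero is smooth.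
theorem smul_contract_mem_smoothSection (ρ : SmoothFunction 𝕜 H M) (hρ : tsupport ρ.1 ⊆ e₂.baseSet)
    (u : SmoothSection 𝕜 H (TensorFibre 𝕜 F₁ F₂) (TensorBundle 𝕜 E₁ E₂)) :
    (fun x => ρ.1 x • contract 𝕜 E₁ e₂ ε x (u x)) ∈ smoothSectionSubmodule 𝕜 H F₁ E₁ := by
  refine SmoothSection.contMDiff_of_coord 𝕜 H _ _ fun x => ?_
  let e₁ := trivializationAt F₁ E₁ x
  have hx₁ : x ∈ e₁.baseSet := mem_baseSet_trivializationAt F₁ E₁ x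
  refine ⟨e₁, inferInstance, hx₁, ?_⟩
  by_cases hx : x ∈ tsupport ρ.1
  · have hx₂ : x ∈ e₁.baseSet ∩ e₂.baseSet := ⟨hx₁, hρ hx⟩
    refine ContMDiffAt.congr_of_eventuallyEq (f := fun y =>
      (contractL 𝕜 F₁ ε).bilinearRestrictScalars ℝ (ρ.1 y)
        (trivialization 𝕜 e₁ e₂ ⟨y, u y⟩).2) ?_ ?_
    · have hρs : ContMDiff 𝓘(ℝ, H) 𝓘(ℝ, 𝕜) ∞ ρ.1 := ρ.2
      exact ((ContinuousLinearMap.contDiff _).contMDiff.contMDiffAt.comp x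
        hρs.contMDiffAt).clm_apply (u.contMDiffAt_coord (trivialization 𝕜 e₁ e₂) hx₂)
    · filter_upwards [e₁.open_baseSet.mem_nhds hx₁] with y hy
      exact coord_smul_contract 𝕜 e₁ e₂ ε hy _ _
  · refine (contMDiffAt_const (c := (0 : F₁))).congr_of_eventuallyEq ?_
    filter_upwards [e₁.open_baseSet.mem_nhds hx₁,
      (isClosed_tsupport ρ.1).isOpen_compl.mem_nhds hx] with y hy hyρ
    rw [image_eq_zero_of_notMem_tsupport hyρ, zero_smul]
    exact coord_zero 𝕜 e₁ hy

variable [IsManifold 𝓘(ℝ, H) ∞ M]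

/-- At points of the closed support of `ρ` the Leibniz estimate applies; at all other points the
germ of the contraction is zero. -/
theorem exists_bound_smul_contract (ρ : SmoothFunction 𝕜 H M) (hρ : tsupport ρ.1 ⊆ e₂.baseSet)
    {B : Set (SmoothSection 𝕜 H (TensorFibre 𝕜 F₁ F₂) (TensorBundle 𝕜 E₁ E₂))}
    (hB : ∀ i : SmoothSection.SeminormIndex H (TensorFibre 𝕜 F₁ F₂) (TensorBundle 𝕜 E₁ E₂),
      ∃ C, 0 ≤ C ∧ ∀ u ∈ B, i.toSeminorm u ≤ C)
    (i : SmoothSection.SeminormIndex H F₁ E₁) :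
    ∃ C, 0 ≤ C ∧ ∀ u ∈ B, i.toSeminorm (𝕜 := 𝕜)
      ⟨_, smul_contract_mem_smoothSection 𝕜 H e₂ ε ρ hρ u⟩ ≤ C := by
  obtain ⟨φ, hφ, e₁, he₁, K, hK, hsub, n⟩ := i
  -- `K` itself need not lie in the base set of `e₂`. Its intersection with the closed support of
  -- `ρ` does, and it stays compact, so it is admissible for seminorms in `e₁ ⊗ e₂`.
  let K' := K ∩ tsupport ρ.1
  have hK' : IsCompact K' := hK.inter_right (isClosed_tsupport _)
  let i₂ : ℕ → SmoothSection.SeminormIndex H (TensorFibre 𝕜 F₁ F₂) (TensorBundle 𝕜 E₁ E₂) :=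
    fun j => ⟨φ, hφ, trivialization 𝕜 e₁ e₂, inferInstance, K', hK',
      fun x hx => ⟨(hsub hx.1).1, (hsub hx.1).2, hρ hx.2⟩, j⟩
  have hρφ : ContDiffOn ℝ ∞ (fun y => ρ.1 (φ.symm y)) φ.target := by
    rw [← contMDiffOn_iff_contDiffOn]
    exact ContMDiff.comp_contMDiffOn ρ.2 (contMDiffOn_symm_of_mem_maximalAtlas
      (IsManifold.subset_maximalAtlas hφ))
  have hρb : ∀ j : ℕ, ∃ C, 0 ≤ C ∧ ∀ x ∈ K', ‖iteratedFDerivWithin ℝ j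
      (fun y => ρ.1 (φ.symm y)) φ.target (φ x)‖ ≤ C := by
    intro j
    have hc : ContinuousOn (fun x : M => iteratedFDerivWithin ℝ j
        (fun y => ρ.1 (φ.symm y)) φ.target (φ x)) K' :=
      (hρφ.continuousOn_iteratedFDerivWithin (m := j) (by exact_mod_cast le_top)
        φ.open_target.uniqueDiffOn).comp
        (φ.continuousOn.mono fun x hx => (hsub hx.1).1) fun x hx => φ.map_source (hsub hx.1).1
    obtain ⟨C, hC⟩ := hK'.exists_bound_of_continuousOn hc
    exact ⟨max C 0, le_max_right _ _, fun x hx => (hC x hx).trans (le_max_left _ _)⟩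
  choose C₁ hC₁ hb₁ using hρb
  choose C₂ hC₂ hb₂ using fun j => hB (i₂ j)
  obtain ⟨C, hC, h⟩ := exists_iteratedFDerivWithin_bilinear_bound (D := H)
    ((contractL 𝕜 F₁ ε).bilinearRestrictScalars ℝ) n hC₁ hC₂
  refine ⟨C, hC, fun u hu => SmoothSection.SeminormIndex.toSeminorm_le _ _ hC fun x hx => ?_⟩
  have hU₁ := SmoothSection.isOpen_localDomain φ e₁
  have hU := SmoothSection.isOpen_localDomain φ (trivialization 𝕜 e₁ e₂)
  have hxU₁ : φ x ∈ SmoothSection.localDomain φ e₁ :=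
    SmoothSection.SeminormIndex.map_mem ⟨φ, hφ, e₁, he₁, K, hK, hsub, n⟩ ⟨x, hx⟩
  by_cases hxρ : x ∈ tsupport ρ.1
  · have hxU : φ x ∈ SmoothSection.localDomain φ (trivialization 𝕜 e₁ e₂) :=
      (i₂ n).map_mem ⟨x, hx, hxρ⟩
    have key := h hU φ.open_target hU (fun y hy => hy.1) subset_rfl hxU hρφ
      (SmoothSection.contDiffOn_localRep hφ (trivialization 𝕜 e₁ e₂) u)
      (h := SmoothSection.localRep φ e₁ fun x => ρ.1 x • contract 𝕜 E₁ e₂ ε x (u x))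
      (fun y hy => coord_smul_contract 𝕜 e₁ e₂ ε hy.2.1 _ _)
      (fun j => hb₁ j x ⟨hx, hxρ⟩)
      (fun j => ((i₂ j).le_toSeminorm u ⟨hx, hxρ⟩).trans (hb₂ j u hu))
    -- The bound was obtained on the smaller domain of `e₁ ⊗ e₂`; the seminorm differentiates on
    -- that of `e₁`.
    rw [iteratedFDerivWithin_eq_of_eventuallyEq_of_isOpen hU hU₁ hxU hxU₁ .rfl] at key
    exact key
  · have hzero : SmoothSection.localRep φ e₁ (fun x => ρ.1 x • contract 𝕜 E₁ e₂ ε x (u x))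
        =ᶠ[𝓝 (φ x)] 0 := by
      have hxs : x ∈ φ.source := (hsub hx).1
      have hc := (φ.continuousAt_symm (φ.map_source hxs)).preimage_mem_nhds
        (t := (tsupport ρ.1)ᶜ) (by
          rw [φ.left_inv hxs]
          exact (isClosed_tsupport ρ.1).isOpen_compl.mem_nhds hxρ)
      filter_upwards [hc, hU₁.mem_nhds hxU₁] with y hy hyU
      change (e₁ ⟨φ.symm y, ρ.1 (φ.symm y) • _⟩).2 = 0
      rw [image_eq_zero_of_notMem_tsupport hy, zero_smul]
      exact coord_zero 𝕜 e₁ hyU.2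
    have key : iteratedFDerivWithin ℝ n (SmoothSection.localRep φ e₁
        (fun x => ρ.1 x • contract 𝕜 E₁ e₂ ε x (u x)))
        (SmoothSection.localDomain φ e₁) (φ x) = 0 := by
      rw [iteratedFDerivWithin_eq_of_eventuallyEq_of_isOpen hU₁ hU₁ hxU₁ hxU₁ hzero]
      simp
    exact (norm_eq_zero.2 key).trans_le hC

/-- The contraction `u ↦ ρ • (id ⊗ (ε ∘ e₂))(u)` of compactly supported sections. -/
def contractCompact (ρ : SmoothFunction 𝕜 H M) (hρ : tsupport ρ.1 ⊆ e₂.baseSet) :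
    CompactSection 𝕜 H (TensorFibre 𝕜 F₁ F₂) (TensorBundle 𝕜 E₁ E₂) →ₗ[𝕜]
      CompactSection 𝕜 H F₁ E₁ where
  toFun u := ⟨⟨_, smul_contract_mem_smoothSection 𝕜 H e₂ ε ρ hρ u.1⟩,
    u.2.of_isClosed_subset isClosed_closure (SmoothSection.support_subset_of_forall fun x h =>
      show ρ.1 x • contract 𝕜 E₁ e₂ ε x (u x) = 0 by rw [h, map_zero, smul_zero])⟩
  map_add' u u' := CompactSection.ext fun x =>
    show ρ.1 x • contract 𝕜 E₁ e₂ ε x (u x + u' x) = _ by rw [map_add, smul_add]; rfl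
  map_smul' c u := CompactSection.ext fun x =>
    show ρ.1 x • contract 𝕜 E₁ e₂ ε x (c • u x) = c • (ρ.1 x • contract 𝕜 E₁ e₂ ε x (u x)) by
      rw [map_smul, smul_comm]

theorem isBoundedMap_contractCompact [T2Space M] [SigmaCompactSpace M] [LocallyCompactSpace M]
    (ρ : SmoothFunction 𝕜 H M) (hρ : tsupport ρ.1 ⊆ e₂.baseSet) :
    IsBoundedMap 𝕜 (contractCompact 𝕜 (F₁ := F₁) (E₁ := E₁) e₂ ε ρ hρ) := by
  intro B hB
  obtain ⟨⟨L, hL, hsup⟩, hb⟩ := CompactSection.isVonNBounded_iff.1 hB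
  refine CompactSection.isVonNBounded_iff.2 ⟨⟨L, hL, ?_⟩, fun i => ?_⟩
  · rintro _ ⟨u, hu, rfl⟩
    refine subset_trans (SmoothSection.support_subset_of_forall fun x h => ?_) (hsup u hu)
    change ρ.1 x • contract 𝕜 E₁ e₂ ε x (u x) = 0
    rw [h, map_zero, smul_zero]
  · obtain ⟨C, hC, h⟩ := exists_bound_smul_contract 𝕜 e₂ ε ρ hρ
      (B := CompactSection.incl 𝕜 H _ _ '' B) (fun i => by
        obtain ⟨C, hC, h⟩ := hb i
        exact ⟨C, hC, by rintro _ ⟨s, hs, rfl⟩; exact h s hs⟩) i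
    refine ⟨C, hC, ?_⟩
    rintro _ ⟨u, hu, rfl⟩
    exact h _ ⟨u, hu, rfl⟩

end Contraction

end TensorBundle

theorem Finset.sum_smul_of_sum_eq_one {ι R V : Type*} [Semiring R] [AddCommMonoid V] [Module R V]
    {s : Finset ι} {c : ι → R} (h : ∑ i ∈ s, c i = 1) (v : V) : ∑ i ∈ s, c i • v = v := by
  rw [← Finset.sum_smul, h, one_smul]

/-! ### Cutoff functions and partitions of unity -/

section Partition

variable {𝕜 H : Type*} {M : Type*} [RCLike 𝕜] [NormedAddCommGroup H] [NormedSpace ℝ H]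
  [FiniteDimensional ℝ H] [TopologicalSpace M] [T2Space M] [SigmaCompactSpace M]
  [LocallyCompactSpace M] [ChartedSpace H M] [IsManifold 𝓘(ℝ, H) ∞ M]

variable (𝕜) in
/-- A real smooth function as a `𝕜`-valued smooth function. -/
def SmoothFunction.ofReal {M : Type*} [TopologicalSpace M] [ChartedSpace H M]
    (f : C^∞⟮𝓘(ℝ, H), M; 𝓘(ℝ), ℝ⟯) : SmoothFunction 𝕜 H M :=
  ⟨fun x => (f x : 𝕜), (RCLike.ofRealCLM (K := 𝕜)).contDiff.contMDiff.comp f.contMDiff⟩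

theorem SmoothFunction.tsupport_ofReal_subset {M : Type*} [TopologicalSpace M] [ChartedSpace H M]
    (f : C^∞⟮𝓘(ℝ, H), M; 𝓘(ℝ), ℝ⟯) : tsupport (SmoothFunction.ofReal 𝕜 f).1 ⊆ tsupport f :=
  closure_mono fun x hx h => hx (by change ((f x : ℝ) : 𝕜) = 0; rw [h, RCLike.ofReal_zero])

variable (𝕜 H) in
-- A smooth Urysohn function that vanishes near, and not merely on, the complement of `interior L`;
-- hence its closed support lies in `L`.
theorem SmoothFunction.exists_eq_one_eq_zero {K L : Set M} (hK : IsClosed K)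
    (hKL : K ⊆ interior L) :
    ∃ χ : SmoothFunction 𝕜 H M, (∀ x ∈ K, χ.1 x = 1) ∧ tsupport χ.1 ⊆ L := by
  obtain ⟨f, h0, h1, -⟩ := exists_contMDiffMap_zero_one_nhds_of_isClosed 𝓘(ℝ, H) (n := (⊤ : ℕ∞))
    isOpen_interior.isClosed_compl hK (subset_compl_iff_disjoint_left.1 (by rwa [compl_compl]))
  refine ⟨SmoothFunction.ofReal 𝕜 f, fun x hx => ?_,
    (SmoothFunction.tsupport_ofReal_subset f).trans fun x hx => ?_⟩
  · change ((f x : ℝ) : 𝕜) = 1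
    rw [h1.self_of_nhdsSet x hx, RCLike.ofReal_one]
  · by_contra hxL
    refine notMem_tsupport_iff_eventuallyEq.2 ?_ hx
    exact Filter.Eventually.filter_mono
      (nhds_le_nhdsSet
      (show x ∈ (interior L)ᶜ from fun h => hxL (interior_subset h))) h0

variable (𝕜 H) in
/-- A smooth partition of unity `ρ` subordinate to an open cover together with smooth functions
`χ i` supported in the same sets and equal to `1` on the support of `ρ i`. -/
theorem SmoothFunction.exists_partition {ι : Type*} {U : ι → Set M} (hU : ∀ i, IsOpen (U i))
    (hcov : ∀ x, ∃ i, x ∈ U i) :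
    ∃ ρ χ : ι → SmoothFunction 𝕜 H M, (∀ i, tsupport (ρ i).1 ⊆ U i) ∧
      (∀ i, tsupport (χ i).1 ⊆ U i) ∧ LocallyFinite (fun i => Function.support (ρ i).1) ∧
      (∀ i x, (χ i).1 x * (ρ i).1 x = (ρ i).1 x) ∧
      ∀ (x : M) (S : Finset ι), (∀ i ∉ S, (ρ i).1 x = 0) → ∑ i ∈ S, (ρ i).1 x = 1 := by
  obtain ⟨f, hf⟩ := SmoothPartitionOfUnity.exists_isSubordinate 𝓘(ℝ, H) isClosed_univ U hU
    fun x _ => mem_iUnion.2 (hcov x)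
  have hχ := fun i => SmoothFunction.exists_eq_one_eq_zero 𝕜 H (isClosed_tsupport (f i))
    (L := U i) (by rw [(hU i).interior_eq]; exact hf i)
  choose χ hχ1 hχU using hχ
  have hval : ∀ i x, (SmoothFunction.ofReal 𝕜 (f i)).1 x = ((f i x : ℝ) : 𝕜) := fun _ _ => rfl
  refine ⟨fun i => SmoothFunction.ofReal 𝕜 (f i), χ,
    fun i => (SmoothFunction.tsupport_ofReal_subset _).trans (hf i), hχU,
    f.locallyFinite.subset fun i x hx h => hx ?_, fun i x => ?_, fun x S hS => ?_⟩
  · rw [hval, h, RCLike.ofReal_zero]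
  · by_cases hx : x ∈ tsupport (f i)
    · rw [hχ1 i x hx, one_mul]
    · rw [hval, image_eq_zero_of_notMem_tsupport hx, RCLike.ofReal_zero, mul_zero]
  -- The sum is taken over any finite set containing all indices active at `x`, so one such set can
  -- later serve all points of a compact set.
  · have h1 := f.sum_eq_one (mem_univ x)
    rw [finsum_eq_sum_of_support_subset (s := S)] at h1
    · simp only [hval]
      rw [← RCLike.ofReal_sum, h1, RCLike.ofReal_one]
    · intro i hi
      by_contra hiS
      exact hi (by simpa [hval] using hS i hiS)

end Partition

/-! ### Local frames extended by cutoffs, and expansions in them -/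

section Frame

variable {𝕜 : Type*} [RCLike 𝕜]
variable {H M : Type*} [NormedAddCommGroup H] [NormedSpace ℝ H]
  [TopologicalSpace M] [ChartedSpace H M]
  {F : Type*} [NormedAddCommGroup F] [NormedSpace 𝕜 F] [NormedSpace ℝ F] [IsScalarTower ℝ 𝕜 F]
  [FiniteDimensional 𝕜 F]
  {E : M → Type*} [TopologicalSpace (TotalSpace F E)]
  [∀ x, AddCommGroup (E x)] [∀ x, Module 𝕜 (E x)] [∀ x, TopologicalSpace (E x)]
  [FiberBundle F E] [VectorBundle 𝕜 F E] [SmoothVectorBundle 𝕜 H F E]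
  (e : Trivialization F (π F E)) [MemTrivializationAtlas e]

namespace SmoothSection

/-- The section equal to the constant `χ • v` in the trivialization `e`, extended by zero. -/
def ofTrivialization (χ : SmoothFunction 𝕜 H M) (hχ : tsupport χ.1 ⊆ e.baseSet) (v : F) :
    SmoothSection 𝕜 H F E :=
  ⟨fun x => χ.1 x • e.symmₗ 𝕜 x v, by
    refine SmoothSection.contMDiff_of_coord 𝕜 H _ _ fun x => ?_
    by_cases hx : x ∈ tsupport χ.1
    · refine ⟨e, inferInstance, hχ hx, ?_⟩
      have hχs : ContMDiff 𝓘(ℝ, H) 𝓘(ℝ, 𝕜) ∞ χ.1 := χ.2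
      refine ContMDiffAt.congr_of_eventuallyEq (f := fun y => χ.1 y • v)
        ((((ContinuousLinearMap.id ℝ 𝕜).smulRight v).contDiff.contMDiff.contMDiffAt).comp x
          hχs.contMDiffAt) ?_
      filter_upwards [e.open_baseSet.mem_nhds (hχ hx)] with y hy
      have h : (e ⟨y, χ.1 y • e.symmₗ 𝕜 y v⟩).2 = e.linearMapAt 𝕜 y (χ.1 y • e.symmₗ 𝕜 y v) := by
        rw [Trivialization.linearMapAt_apply, if_pos hy]
      rw [h, map_smul, e.linearMapAt_symmₗ hy]
    · have hx₁ := mem_baseSet_trivializationAt F E x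
      refine ⟨trivializationAt F E x, inferInstance, hx₁, ?_⟩
      refine (contMDiffAt_const (c := (0 : F))).congr_of_eventuallyEq ?_
      filter_upwards [(trivializationAt F E x).open_baseSet.mem_nhds hx₁,
        (isClosed_tsupport χ.1).isOpen_compl.mem_nhds hx] with y hy hyχ
      rw [image_eq_zero_of_notMem_tsupport hyχ, zero_smul]
      exact TensorBundle.coord_zero 𝕜 _ hy⟩

/-- The smooth function `ρ · ε(e(t))`, extended by zero. -/
def coeff (ε : F →ₗ[𝕜] 𝕜) (ρ : SmoothFunction 𝕜 H M) (hρ : tsupport ρ.1 ⊆ e.baseSet)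
    (t : SmoothSection 𝕜 H F E) : SmoothFunction 𝕜 H M :=
  ⟨fun x => ρ.1 x * ε (e.linearMapAt 𝕜 x (t x)), by
    intro x
    by_cases hx : x ∈ tsupport ρ.1
    · have hρs : ContMDiff 𝓘(ℝ, H) 𝓘(ℝ, 𝕜) ∞ ρ.1 := ρ.2
      have h := ((LinearMap.toContinuousLinearMap ε).restrictScalars
        ℝ).contDiff.contMDiff.contMDiffAt.comp x (t.contMDiffAt_coord e (hρ hx))
      refine (((isBoundedBilinearMap_mul (𝕜 := ℝ) (A := 𝕜)).contDiff.contMDiff.contMDiffAt).comp x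
        (hρs.contMDiffAt.prodMk_space h)).congr_of_eventuallyEq ?_
      filter_upwards [e.open_baseSet.mem_nhds (hρ hx)] with y hy
      rw [Trivialization.linearMapAt_apply, if_pos hy]
      rfl
    · refine (contMDiffAt_const (c := (0 : 𝕜))).congr_of_eventuallyEq ?_
      filter_upwards [(isClosed_tsupport ρ.1).isOpen_compl.mem_nhds hx] with y hy
      rw [image_eq_zero_of_notMem_tsupport hy, zero_mul]⟩

variable (𝕜 H F E) in
/-- Evaluation of sections at a point. -/
def eval (x : M) : SmoothSection 𝕜 H F E →ₗ[𝕜] E x where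
  toFun s := s x
  map_add' _ _ := rfl
  map_smul' _ _ := rfl

end SmoothSection

namespace TensorBundle

variable {E₁ : M → Type*} [∀ x, AddCommGroup (E₁ x)] [∀ x, Module 𝕜 (E₁ x)]
  [∀ x, TopologicalSpace (E₁ x)]

/-- The expansion of `w` in the frame given by `e` and `b`, weighted by `a = ρ i x` on the
coefficients and `c = χ i x` on the frame. Outside the base set the weight `a` vanishes, and so do
both sides. -/
theorem sum_coord_smul_symm {κ : Type*} [Fintype κ] (b : Module.Basis κ 𝕜 F) {x : M}
    {a : 𝕜} (ha : a ≠ 0 → x ∈ e.baseSet) (c : 𝕜) (w : E x) :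
    ∑ j, (a * b.coord j (e.linearMapAt 𝕜 x w)) • c • e.symmₗ 𝕜 x (b j) = (c * a) • w := by
  rcases eq_or_ne a 0 with rfl | ha0
  · simp
  have hx := ha ha0
  have h : ∑ j, b.coord j (e.linearMapAt 𝕜 x w) • e.symmₗ 𝕜 x (b j) = w := by
    simp_rw [← map_smul]
    rw [← map_sum]
    simp_rw [Module.Basis.coord_apply]
    rw [b.sum_repr, e.symmₗ_linearMapAt hx]
  conv_rhs => rw [← h, Finset.smul_sum]
  refine Finset.sum_congr rfl fun j _ => ?_
  rw [smul_smul, smul_smul]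
  congr 1
  ring

/-- By additivity it suffices to treat `z = v ⊗ w`. There the contraction is a scalar multiple of
`v`; moving the scalar to the right factor leaves `v ⊗` the expansion of `w`. -/
theorem sum_contract_tmul_symm {κ : Type*} [Fintype κ] (b : Module.Basis κ 𝕜 F) {x : M}
    {a : 𝕜} (ha : a ≠ 0 → x ∈ e.baseSet) (c : 𝕜) (z : TensorBundle 𝕜 E₁ E x) :
    ∑ j, tmul 𝕜 (a • contract 𝕜 E₁ e (b.coord j) x z) (c • e.symmₗ 𝕜 x (b j)) = (c * a) • z := by
  have hadd : ∀ z z' : TensorBundle 𝕜 E₁ E x, ∀ j,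
      tmul 𝕜 (a • contract 𝕜 E₁ e (b.coord j) x (z + z')) (c • e.symmₗ 𝕜 x (b j)) =
      tmul 𝕜 (a • contract 𝕜 E₁ e (b.coord j) x z) (c • e.symmₗ 𝕜 x (b j)) +
      tmul 𝕜 (a • contract 𝕜 E₁ e (b.coord j) x z') (c • e.symmₗ 𝕜 x (b j)) := fun z z' j => by
    rw [map_add, smul_add]
    exact TensorProduct.add_tmul _ _ _
  refine TensorProduct.induction_on (motive := fun z : TensorBundle 𝕜 E₁ E x =>
    ∑ j, tmul 𝕜 (a • contract 𝕜 E₁ e (b.coord j) x z) (c • e.symmₗ 𝕜 x (b j)) = (c * a) • z)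
    z ?_ (fun v w => ?_) fun z z' hz hz' => ?_
  · change ∑ j, tmul 𝕜 (a • contract 𝕜 E₁ e (b.coord j) x 0) (c • e.symmₗ 𝕜 x (b j)) = _
    rw [Finset.sum_eq_zero fun j _ => ?_]
    · exact (smul_zero (c * a)).symm
    · rw [map_zero, smul_zero]
      exact TensorProduct.zero_tmul _ _
  · have h := congrArg (TensorProduct.mk 𝕜 (E₁ x) (E x) v) (sum_coord_smul_symm e b ha c w)
    rw [map_sum, map_smul] at h
    refine Eq.trans (Finset.sum_congr rfl fun j _ => ?_) h
    refine (congrArg (fun v' => tmul 𝕜 (a • v') (c • e.symmₗ 𝕜 x (b j)))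
      (contract_tmul 𝕜 e (b.coord j) v w)).trans ?_
    rw [smul_smul]
    exact TensorProduct.smul_tmul _ _ _
  · refine (Finset.sum_congr rfl fun j _ => hadd z z' j).trans ?_
    rw [Finset.sum_add_distrib, hz, hz']
    exact (smul_add (c * a) z z').symm

end TensorBundle

end Frame

end

/-! ### The isomorphism -/

theorem theorem6p3 {𝕜 : Type*} [RCLike 𝕜]
    {H : Type*} [NormedAddCommGroup H] [NormedSpace ℝ H] [FiniteDimensional ℝ H]
    {M : Type*} [TopologicalSpace M] [T2Space M] [SecondCountableTopology M]
    [ChartedSpace H M] [IsManifold 𝓘(ℝ, H) ∞ M]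
    {F₁ : Type*} [NormedAddCommGroup F₁] [NormedSpace 𝕜 F₁] [NormedSpace ℝ F₁]
    [IsScalarTower ℝ 𝕜 F₁] [FiniteDimensional 𝕜 F₁]
    {E : M → Type*} [TopologicalSpace (TotalSpace F₁ E)]
    [∀ x, AddCommGroup (E x)] [∀ x, Module 𝕜 (E x)] [∀ x, TopologicalSpace (E x)]
    [FiberBundle F₁ E] [VectorBundle 𝕜 F₁ E] [SmoothVectorBundle 𝕜 H F₁ E]
    {F₂ : Type*} [NormedAddCommGroup F₂] [NormedSpace 𝕜 F₂] [NormedSpace ℝ F₂]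
    [IsScalarTower ℝ 𝕜 F₂] [FiniteDimensional 𝕜 F₂]
    {F : M → Type*} [TopologicalSpace (TotalSpace F₂ F)]
    [∀ x, AddCommGroup (F x)] [∀ x, Module 𝕜 (F x)] [∀ x, TopologicalSpace (F x)]
    [FiberBundle F₂ F] [VectorBundle 𝕜 F₂ F] [SmoothVectorBundle 𝕜 H F₂ F] :
    ∃ Φ : BornologicalTensor 𝕜 (SmoothFunction 𝕜 H M)
          (CompactSection 𝕜 H F₁ E) (SmoothSection 𝕜 H F₂ F)
        ≃ₗ[SmoothFunction 𝕜 H M]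
        CompactSection 𝕜 H (TensorFibre 𝕜 F₁ F₂) (TensorBundle 𝕜 E F),
      (∀ (s : CompactSection 𝕜 H F₁ E) (t : SmoothSection 𝕜 H F₂ F) (x : M),
        Φ (BornologicalTensor.tmul 𝕜 (SmoothFunction 𝕜 H M) s t) x
          = TensorBundle.tmul 𝕜 (s x) (t x)) ∧
      IsBoundedMap 𝕜 Φ ∧ IsBoundedMap 𝕜 Φ.symm := by
  have : LocallyCompactSpace M := Manifold.locallyCompact_of_finiteDimensional 𝓘(ℝ, H)
  have : ContinuousSMul 𝕜 (SmoothSection 𝕜 H F₂ F) :=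
    (SmoothSection.withSeminorms (𝕜 := 𝕜) (H := H) (F := F₂) (E := F)).continuousSMul
  -- The cover is indexed by all points of `M`; local finiteness of the partition is what makes the
  -- sums below finite.
  let e : M → Trivialization F₂ (π F₂ F) := trivializationAt F₂ F
  let b := Module.finBasis 𝕜 F₂
  obtain ⟨ρ, χ, hρ, hχ, hlf, hχρ, hsum⟩ := SmoothFunction.exists_partition 𝕜 H
    (U := fun i => (e i).baseSet) (fun i => (e i).open_baseSet)
    fun x => ⟨x, mem_baseSet_trivializationAt F₂ F x⟩
  let κ := M × Fin (Module.finrank 𝕜 F₂)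
  -- The frame carries `χ` and the coefficients carry `ρ`: both extend smoothly by zero, and the
  -- product `χ * ρ = ρ` still sums to one.
  let t : κ → SmoothSection 𝕜 H F₂ F := fun k =>
    SmoothSection.ofTrivialization (e k.1) (χ k.1) (hχ k.1) (b k.2)
  let P : κ → CompactSection 𝕜 H (TensorFibre 𝕜 F₁ F₂) (TensorBundle 𝕜 E F) →ₗ[𝕜]
      CompactSection 𝕜 H F₁ E := fun k =>
    TensorBundle.contractCompact 𝕜 (e k.1) (b.coord k.2) (ρ k.1) (hρ k.1)
  have hfinset : ∀ L : Set M, IsCompact L → ∃ I : Finset M, ∀ i ∉ I, ∀ x ∈ L, (ρ i).1 x = 0 := by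
    intro L hL
    refine ⟨(hlf.finite_nonempty_inter_compact hL).toFinset, fun i hi x hx => ?_⟩
    by_contra h
    exact hi ((Set.Finite.mem_toFinset _).2 ⟨x, h, hx⟩)
  have hPzero : ∀ (L : Set M) (I : Finset M), (∀ i ∉ I, ∀ x ∈ L, (ρ i).1 x = 0) →
      ∀ u : CompactSection 𝕜 H (TensorFibre 𝕜 F₁ F₂) (TensorBundle 𝕜 E F),
      SmoothSection.support u ⊆ L → ∀ k ∉ I ×ˢ Finset.univ, P k u = 0 := by
    intro L I hI u hu k hk
    refine CompactSection.ext fun x => ?_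
    change (ρ k.1).1 x • TensorBundle.contract 𝕜 E (e k.1) (b.coord k.2) x (u x) = 0
    by_cases hx : x ∈ L
    · rw [hI k.1 (fun h => hk (by simp [h])) x hx, zero_smul]
    · have h0 : u x = 0 := by
        by_contra h
        exact hx (hu (subset_closure h))
      rw [h0, map_zero, smul_zero]
  have hbase : ∀ i x, (ρ i).1 x ≠ 0 → x ∈ (e i).baseSet := fun i x h =>
    hρ i (subset_tsupport _ h)
  have hone : ∀ (x : M) (I : Finset M), (∀ i ∉ I, (ρ i).1 x = 0) →
      ∑ i ∈ I, (χ i).1 x * (ρ i).1 x = 1 := by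
    intro x I hI
    simp_rw [hχρ]
    exact hsum x I hI
  refine BornologicalTensor.exists_linearEquiv (TensorBundle.tmulCompact 𝕜 H F₁ E F₂ F)
    (TensorBundle.tmulCompact_smul 𝕜) (TensorBundle.isBoundedMap_tmulCompact 𝕜) t P
    (fun k => TensorBundle.isBoundedMap_contractCompact 𝕜 _ _ _ _) ?_ ?_ ?_
    |>.imp fun Φ hΦ => ⟨fun s t x => by rw [hΦ.1]; rfl, hΦ.2⟩
  · intro B hB
    obtain ⟨L, hL, hsup⟩ := CompactSection.exists_compact_of_isVonNBounded hB
    obtain ⟨I, hI⟩ := hfinset L hL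
    exact ⟨I ×ˢ Finset.univ, fun u hu => hPzero L I hI u (hsup u hu)⟩
  · intro u
    refine CompactSection.ext fun x => ?_
    -- The point `x` is adjoined so that `I` contains every index active at `x`, even when `x` is
    -- outside the support of `u`.
    obtain ⟨I, hI⟩ := hfinset (SmoothSection.support u ∪ {x}) (u.2.union isCompact_singleton)
    have hk := hPzero _ I hI u subset_union_left
    rw [finsum_eq_sum_of_support_subset (s := I ×ˢ Finset.univ) _ ?_]
    · let ev : CompactSection 𝕜 H (TensorFibre 𝕜 F₁ F₂) (TensorBundle 𝕜 E F) →ₗ[𝕜]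
          TensorBundle 𝕜 E F x :=
        SmoothSection.eval 𝕜 H (TensorFibre 𝕜 F₁ F₂) (TensorBundle 𝕜 E F) x ∘ₗ
        (CompactSection.incl 𝕜 H (TensorFibre 𝕜 F₁ F₂) (TensorBundle 𝕜 E F)).restrictScalars 𝕜
      change ev (∑ k ∈ I ×ˢ Finset.univ, TensorBundle.tmulCompact 𝕜 H F₁ E F₂ F (P k u) (t k)) = u x
      rw [map_sum, Finset.sum_product]
      refine Eq.trans (Finset.sum_congr rfl fun i _ => ?_)
        (Finset.sum_smul_of_sum_eq_one (hone x I fun i hi => hI i hi x (Or.inr rfl)) (u x))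
      exact TensorBundle.sum_contract_tmul_symm (E₁ := E) (e i) b (hbase i x) ((χ i).1 x) (u x)
    · intro k hkS
      by_contra h
      refine hkS ?_
      change TensorBundle.tmulCompact 𝕜 H F₁ E F₂ F (P k u) (t k) = 0
      rw [hk k h, map_zero, LinearMap.zero_apply]
  · intro s w
    -- `L` is a compact neighbourhood of the support of `s`, which leaves room for a cutoff `η`
    -- equal to one on that support and supported in `L`.
    obtain ⟨L, hL, hsL⟩ := exists_compact_superset s.2
    obtain ⟨η, hη1, hηL⟩ := SmoothFunction.exists_eq_one_eq_zero 𝕜 H isClosed_closure hsL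
    obtain ⟨I, hI⟩ := hfinset L hL
    let lam : κ → SmoothFunction 𝕜 H M := fun k =>
      SmoothSection.coeff (e k.1) (b.coord k.2) (ρ k.1) (hρ k.1) w
    have hPlam : ∀ k, P k (TensorBundle.tmulCompact 𝕜 H F₁ E F₂ F s w) = lam k • s := by
      intro k
      refine CompactSection.ext fun x => ?_
      change (ρ k.1).1 x • TensorBundle.contract 𝕜 E (e k.1) (b.coord k.2) x
        (TensorBundle.tmul 𝕜 (s x) (w x)) = ((ρ k.1).1 x * _) • s x
      rw [TensorBundle.contract_tmul, smul_smul]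
    have hηs : η • s = s := by
      refine CompactSection.ext fun x => ?_
      change η.1 x • s x = s x
      by_cases hx : s x = 0
      · rw [hx, smul_zero]
      · rw [hη1 x (subset_closure hx), one_smul]
    -- The finite sum reproduces `w` only on `L`, where `I` contains all active indices; after
    -- multiplication by `η` the equality is global.
    have hηw : η • ∑ k ∈ I ×ˢ Finset.univ, lam k • t k = η • w := by
      refine Subtype.ext (funext fun x => ?_)
      change η.1 x • SmoothSection.eval 𝕜 H F₂ F x (∑ k ∈ I ×ˢ Finset.univ, lam k • t k) =
        η.1 x • w x
      by_cases hx : x ∈ L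
      · congr 1
        rw [map_sum, Finset.sum_product]
        refine Eq.trans (Finset.sum_congr rfl fun i _ => ?_)
          (Finset.sum_smul_of_sum_eq_one (hone x I fun i hi => hI i hi x hx) (w x))
        exact TensorBundle.sum_coord_smul_symm (e i) b (hbase i x) ((χ i).1 x) (w x)
      · rw [image_eq_zero_of_notMem_tsupport fun h => hx (hηL h), zero_smul, zero_smul]
    have hsupp := hPzero L I hI (TensorBundle.tmulCompact 𝕜 H F₁ E F₂ F s w)
      ((SmoothSection.support_subset_of_forall fun x h =>
        (congrArg (fun v => TensorBundle.tmul 𝕜 v (w x)) h).trans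
          (TensorProduct.zero_tmul _ _)).trans (hsL.trans interior_subset))
    let mk : SmoothSection 𝕜 H F₂ F →ₗ[𝕜] BornologicalTensor 𝕜 (SmoothFunction 𝕜 H M)
        (CompactSection 𝕜 H F₁ E) (SmoothSection 𝕜 H F₂ F) :=
      BornologicalTensor.mkL 𝕜 (SmoothFunction 𝕜 H M) _ _ ∘ₗ TensorProduct.mk 𝕜 _ _ s
    -- Because `η • s = s` and `η` moves across the tensor sign, `[s ⊗ w']` depends only on `η •
    -- w'`.
    have hmk : ∀ w', BornologicalTensor.tmul 𝕜 (SmoothFunction 𝕜 H M) s (η • w') = mk w' := by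
      intro w'
      rw [← BornologicalTensor.tmul_smul_comm, hηs]
      rfl
    rw [finsum_eq_sum_of_support_subset (s := I ×ˢ Finset.univ) _ ?_]
    · calc ∑ k ∈ I ×ˢ Finset.univ, BornologicalTensor.tmul 𝕜 (SmoothFunction 𝕜 H M)
            (P k (TensorBundle.tmulCompact 𝕜 H F₁ E F₂ F s w)) (t k)
          = ∑ k ∈ I ×ˢ Finset.univ, mk (lam k • t k) := Finset.sum_congr rfl fun k _ => by
            rw [hPlam, BornologicalTensor.tmul_smul_comm]
            rfl
        _ = mk w := by rw [← map_sum, ← hmk, hηw, hmk]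
        _ = BornologicalTensor.tmul 𝕜 (SmoothFunction 𝕜 H M) s w := rfl
    · intro k hkS
      by_contra h
      refine hkS ?_
      change BornologicalTensor.mkL 𝕜 (SmoothFunction 𝕜 H M) _ _
        (P k (TensorBundle.tmulCompact 𝕜 H F₁ E F₂ F s w) ⊗ₜ[𝕜] t k) = 0
      rw [hsupp k h, TensorProduct.zero_tmul, map_zero]
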